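/- **Class of algorithms.** Let $f=\frac1n\sum_{i=1}^n f_i$ on $\mathbb R^m$, with $f_i$ stored at node $i$ and node $1$ the master, and let $c_0,q_0>0$ be constants. For $\gamma>0$ let $\mathrm{prox}^{\gamma}_{g}(x)=\arg\min_u\{g(u)+\frac1{2\gamma}\|x-u\|^2\}$. A *loopless linear-span PIFO algorithm with client sampling* with $T$ rounds, started at $x_0$, fixes a distribution $\mathcal D=(q_1,\dots,q_n)$ on $\{1,\dots,n\}$ with all $q_i>0$ and $\max_{2\le i\le n}q_i\le q_0/n$, and a number $0<p\le c_0/n$; it uses mutually independent random variables $i_t,j_t\sim\mathcal D$ and $a_t\sim\mathrm{Bernoulli}(p)$, $0\le t<T$, and positive step sizes $\gamma_t,\gamma'_t,\gamma''_t$. It sets $\tilde x_0=x_0$ and $\mathcal I_0=\mathrm{span}\{x_0,\nabla f_i(x_0),\mathrm{prox}^{\gamma_0}_{f_i}(x_0): 1\le i\le n\}$, and in round $t$: 1. $\mathcal I^0_{t+1}=\mathrm{span}(\mathcal I_t\cup\{\nabla f_{i_t}(\tilde x_t),\mathrm{prox}^{\gamma_t}_{f_{i_t}}(\tilde x_t)\})$.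 2. $x_{t+1}\in\mathcal I^1_{t+1}=\mathrm{span}\{y,\nabla f_1(z),\mathrm{prox}^{\gamma'_t}_{f_1}(w): y,z,w\in\mathcal I^0_{t+1}\}$. 3. If $a_t=0$, then $\tilde x_{t+1}=x_{t+1}$ and $\mathcal I_{t+1}=\mathcal I^1_{t+1}$. 4. If $a_t=1$, it chooses $y_{t+1}\in\mathcal I^1_{t+1}$, then an anchor point $\tilde y_{t+1}\in\mathrm{span}\{y,\nabla f_1(z),\mathrm{prox}^{\gamma'_t}_{f_1}(w),\nabla f_{j_t}(y_{t+1}),\mathrm{prox}^{\gamma''_{t+1}}_{f_{j_t}}(y_{t+1}): y,z,w\in\mathcal I^1_{t+1}\}$, and $\tilde x_{t+1}\in\mathcal I_{t+1}=\mathrm{span}(\mathcal I^1_{t+1}\cup\{\tilde y_{t+1}\}\cup\{\nabla f_i(\tilde y_{t+1}),\mathrm{prox}^{\gamma_{t+1}}_{f_i}(\tilde y_{t+1}):1\le i\le n\})$. It outputs some $\hat x\in\mathcal I_T$. Its communication cost is the number of transmissions, $2(n-1)+\sum_{t<T}\big(2+a_t(2+2(n-1))\big)$. **Hard instance.** For $n\ge3$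 and $\delta,\mu,\Delta,\varepsilon>0$ put $$\rho=\sqrt{\tfrac{2\delta/\mu}{\sqrt{2n+1}}+1},\quad q=\tfrac{\rho-1}{\rho+1},\quad \lambda=\tfrac{4\Delta}{\rho-1},\quad \beta=\tfrac{4}{\rho-1}\sqrt{\tfrac{\Delta}{\mu(\rho+1)}},\quad \zeta=\sqrt{\tfrac2{1+\rho}},\quad c=\tfrac4{\rho^2-1},$$ assume $\varepsilon\le\frac{\Delta}{9}q^3$, and let $m=\big\lfloor\frac{\log(\Delta/(9\varepsilon))}{2\log(1/q)}+2\big\rfloor$. Let $b_l^\top$ be the $l$-th row of the $m\times m$ upper bidiagonal matrix with diagonal $(1,\dots,1,\zeta)$ and superdiagonal $-1$, and for $2\le i\le n$ let $\mathcal L_i=\{1\le l\le m: l\equiv i-1 \bmod (n-1)\}$. Put $r_1(x)=\frac c2\|x\|^2-n\langle e_1,x\rangle$, $r_i(x)=\frac n2\sum_{l\in\mathcal L_i}(b_l^\top x)^2+\frac c2\|x\|^2$ for $i\ge2$, $f_i(x)=\lambda\, r_i(x/\beta)$ and $f=\frac1n\sum_{i=1}^n f_i$ on $\mathbb R^m$.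 **Theorem.** The function $f$ is $\mu$-strongly convex; the $f_i$ satisfy $\delta$-average second-order similarity, i.e. $\frac1n\sum_{i}\|\nabla(f_i-f)(x)-\nabla(f_i-f)(y)\|^2\le\delta^2\|x-y\|^2$ for all $x,y$; and $f$ has a minimizer $x_*$ with $f(0)-f(x_*)=\Delta$. Moreover, for all $c_0,q_0,K>0$ there is a constant $C>0$ depending only on $c_0,q_0,K$ such that, for all $n\ge 3$ and $\delta,\mu,\Delta,\varepsilon$ as above, every algorithm of the above class that is started at $x_0=0$ on this instance and whose output satisfies $\mathbb E f(\hat x)-f(x_*)<\varepsilon$ has expected communication cost at least $$C\Big(n+n^{3/4}\sqrt{\delta/\mu}\,\log\tfrac{\Delta}{9\varepsilon}\Big)\quad\text{if } \delta/\mu\ge K\sqrt n,$$ $$C\Big(n+\frac{n\log\frac{\Delta}{9\varepsilon}}{1+(\log(\mu\sqrt n/\delta))_+}\Big)\quad\text{if } \delta/\mu\le K\sqrt n,$$ where $(a)_+=\max\{a,0\}$. If in addition $\varepsilon\le(\Delta/9)^2$, both bounds also hold with $\log(1/\varepsilon)$ in place of $\log\frac{\Delta}{9\varepsilon}$. -/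

import Mathlib

open MeasureTheory ProbabilityTheory

noncomputable section

/-- The Euclidean space `ℝ^d` with its `ℓ²` norm. -/
abbrev Vec (d : ℕ) : Type := EuclideanSpace ℝ (Fin d)

/-- The objective `f = (1/n) ∑ i, f i`. -/
def avgFun {n d : ℕ} (f : Fin n → Vec d → ℝ) (x : Vec d) : ℝ :=
  (1 / (n : ℝ)) * ∑ i, f i x

/-- `δ`-average second-order similarity of the differentiable functions `f i`. -/
def AveSS {n d : ℕ} (f : Fin n → Vec d → ℝ) (δ : ℝ) : Prop :=
  (∀ i, Differentiable ℝ (f i)) ∧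
    ∀ x y : Vec d,
      (1 / (n : ℝ)) * ∑ i, ‖gradient (fun z => f i z - avgFun f z) x
          - gradient (fun z => f i z - avgFun f z) y‖ ^ 2
        ≤ δ ^ 2 * ‖x - y‖ ^ 2

/-- The values of the proximal operator: the minimizers of `u ↦ g u + ‖x - u‖² / (2 γ)`. -/
def proxSet {d : ℕ} (g : Vec d → ℝ) (γ : ℝ) (x : Vec d) : Set (Vec d) :=
  {u | IsMinOn (fun v => g v + 1 / (2 * γ) * ‖x - v‖ ^ 2) Set.univ u}

/-- The vectors returned by the proximal incremental first-order oracle of `g` at `x` with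
step size `γ`: the gradient of `g` at `x` and the proximal point. -/
def pifo {d : ℕ} (g : Vec d → ℝ) (γ : ℝ) (x : Vec d) : Set (Vec d) :=
  {gradient g x} ∪ proxSet g γ x

/-- A run, with `T` communication rounds and started at `x₀`, of a randomized algorithm of the
loopless linear-span class with client sampling on the components `f i`.

The points and the step sizes may be arbitrary functions of the random outcome `ω`; only the
constraints below are imposed on them, so that every adaptive or randomized selection rule is
covered. -/
structure LooplessRun {n d : ℕ} (f : Fin n → Vec d → ℝ) (master : Fin n) (c₀ q₀ : ℝ)
    (x₀ : Vec d) (T : ℕ) {Ω : Type*} [MeasurableSpace Ω] (P : Measure Ω) where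
  /-- the sampling distribution over the nodes -/
  q : Fin n → ℝ
  /-- the probability of an anchor point update -/
  p : ℝ
  q_pos : ∀ k, 0 < q k
  q_sum : ∑ k, q k = 1
  q_le : ∀ k, k ≠ master → q k ≤ q₀ / n
  p_pos : 0 < p
  p_le : p ≤ c₀ / n
  /-- the client sampled in round `t` -/
  i : Fin T → Ω → Fin n
  /-- the client sampled before an anchor point update in round `t` -/
  j : Fin T → Ω → Fin n
  /-- the coin of round `t`: whether the anchor point is updated -/
  a : Fin T → Ω → Bool
  i_meas : ∀ t, Measurable (i t)
  j_meas : ∀ t, Measurable (j t)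
  a_meas : ∀ t, Measurable (a t)
  i_law : ∀ t k, P.real {ω | i t ω = k} = q k
  j_law : ∀ t k, P.real {ω | j t ω = k} = q k
  a_law : ∀ t, P.real {ω | a t ω = true} = p
  /-- all the variables `i t`, `j t`, `a t` are mutually independent -/
  indep : iIndep (Sum.elim (fun t : Fin T => MeasurableSpace.comap (i t) inferInstance)
    (Sum.elim (fun t : Fin T => MeasurableSpace.comap (j t) inferInstance)
      (fun t : Fin T => MeasurableSpace.comap (a t) inferInstance))) P
  /-- step sizes of the oracle calls at the sampled client and at the anchor point -/
  γ : ℕ → Ω → ℝ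
  /-- step sizes of the oracle calls at the master node -/
  γm : ℕ → Ω → ℝ
  /-- step sizes of the oracle calls at the client sampled before an anchor point update -/
  γj : ℕ → Ω → ℝ
  γ_pos : ∀ t ω, 0 < γ t ω
  γm_pos : ∀ t ω, 0 < γm t ω
  γj_pos : ∀ t ω, 0 < γj t ω
  /-- the information sets at the beginning of each round -/
  I : ℕ → Ω → Submodule ℝ (Vec d)
  /-- the information sets after the exchange with the sampled client -/
  I0 : ℕ → Ω → Submodule ℝ (Vec d)
  /-- the information sets after the local step of the master node -/
  I1 : ℕ → Ω → Submodule ℝ (Vec d)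
  /-- the point chosen in the local step of the master node -/
  x : ℕ → Ω → Vec d
  /-- the point sent to the client that is sampled next -/
  xt : ℕ → Ω → Vec d
  /-- the point sent to the client sampled before an anchor point update -/
  y : ℕ → Ω → Vec d
  /-- the anchor point -/
  yt : ℕ → Ω → Vec d
  /-- initialization -/
  I_zero : ∀ ω, I 0 ω = Submodule.span ℝ ({x₀} ∪ ⋃ k, pifo (f k) (γ 0 ω) x₀)
  xt_zero : ∀ ω, xt 0 ω = x₀
  /-- exchange with the sampled client -/
  I0_succ : ∀ (t : Fin T) ω, I0 (t + 1) ω =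
    Submodule.span ℝ ((I t ω : Set (Vec d)) ∪ pifo (f (i t ω)) (γ t ω) (xt t ω))
  /-- local step of the master node -/
  I1_succ : ∀ (t : Fin T) ω, I1 (t + 1) ω =
    Submodule.span ℝ ((I0 (t + 1) ω : Set (Vec d)) ∪
      ⋃ z ∈ I0 (t + 1) ω, pifo (f master) (γm t ω) z)
  x_mem : ∀ (t : Fin T) ω, x (t + 1) ω ∈ I1 (t + 1) ω
  /-- no anchor point update -/
  xt_tail : ∀ (t : Fin T) ω, a t ω = false → xt (t + 1) ω = x (t + 1) ω
  I_tail : ∀ (t : Fin T) ω, a t ω = false → I (t + 1) ω = I1 (t + 1) ω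
  /-- anchor point update -/
  y_mem : ∀ (t : Fin T) ω, a t ω = true → y (t + 1) ω ∈ I1 (t + 1) ω
  yt_mem : ∀ (t : Fin T) ω, a t ω = true → yt (t + 1) ω ∈
    Submodule.span ℝ ((I1 (t + 1) ω : Set (Vec d)) ∪
      (⋃ z ∈ I1 (t + 1) ω, pifo (f master) (γm t ω) z) ∪
      pifo (f (j t ω)) (γj (t + 1) ω) (y (t + 1) ω))
  I_head : ∀ (t : Fin T) ω, a t ω = true → I (t + 1) ω =
    Submodule.span ℝ ((I1 (t + 1) ω : Set (Vec d)) ∪ {yt (t + 1) ω} ∪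
      ⋃ k, pifo (f k) (γ (t + 1) ω) (yt (t + 1) ω))
  xt_head : ∀ (t : Fin T) ω, a t ω = true → xt (t + 1) ω ∈ I (t + 1) ω
  /-- the output -/
  out : Ω → Vec d
  out_meas : Measurable out
  out_mem : ∀ ω, out ω ∈ I T ω

/-- The number of vector transmissions of a run: `2 (n - 1)` for the initialization, `2` for the
exchange with the sampled client in each round, and, in a round with an anchor point update,
`2` for the exchange with the second sampled client and `2 (n - 1)` for the anchor point. -/
def LooplessRun.comm {n d : ℕ} {f : Fin n → Vec d → ℝ} {master : Fin n} {c₀ q₀ : ℝ}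
    {x₀ : Vec d} {T : ℕ} {Ω : Type*} [MeasurableSpace Ω] {P : Measure Ω}
    (A : LooplessRun f master c₀ q₀ x₀ T P) (ω : Ω) : ℝ :=
  2 * ((n : ℝ) - 1) + ∑ t : Fin T, (2 + if A.a t ω = true then 2 + 2 * ((n : ℝ) - 1) else 0)

/-! The hard instance. Nodes and coordinates are numbered from `0`; node `0` is the master. -/

/-- The upper bidiagonal matrix with diagonal `1, …, 1, ζ` and superdiagonal `-1`. -/
def hardB (m : ℕ) (ζ : ℝ) : Matrix (Fin m) (Fin m) ℝ :=
  Matrix.of fun l k =>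
    if k = l then (if (l : ℕ) + 1 = m then ζ else 1)
    else if (k : ℕ) = (l : ℕ) + 1 then -1 else 0

/-- The rows of `hardB` given to node `k`: none for the master node, and otherwise the rows
`l` (numbered from `1` here, hence the shift) with `l ≡ k` modulo `n - 1`. -/
def hardRows (n m : ℕ) (k : Fin n) : Finset (Fin m) :=
  Finset.univ.filter fun l => (k : ℕ) ≠ 0 ∧ (l : ℕ) + 1 ≡ (k : ℕ) [MOD (n - 1)]

/-- The unscaled components. -/
def hardR (n m : ℕ) (ζ c : ℝ) (k : Fin n) (x : Vec m) : ℝ :=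
  if (k : ℕ) = 0 then
    c / 2 * ‖x‖ ^ 2 - n * (if h : 0 < m then x ⟨0, h⟩ else 0)
  else
    (n : ℝ) / 2 * ∑ l ∈ hardRows n m k, (∑ s, hardB m ζ l s * x s) ^ 2 + c / 2 * ‖x‖ ^ 2

def hardRho (n : ℕ) (δ μ : ℝ) : ℝ :=
  Real.sqrt (2 * (δ / μ) / Real.sqrt (2 * n + 1) + 1)

def hardQ (n : ℕ) (δ μ : ℝ) : ℝ :=
  (hardRho n δ μ - 1) / (hardRho n δ μ + 1)

def hardLambda (n : ℕ) (δ μ Δ : ℝ) : ℝ :=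
  4 * Δ / (hardRho n δ μ - 1)

def hardBeta (n : ℕ) (δ μ Δ : ℝ) : ℝ :=
  4 / (hardRho n δ μ - 1) * Real.sqrt (Δ / (μ * (hardRho n δ μ + 1)))

def hardZeta (n : ℕ) (δ μ : ℝ) : ℝ :=
  Real.sqrt (2 / (1 + hardRho n δ μ))

def hardC (n : ℕ) (δ μ : ℝ) : ℝ :=
  4 / (hardRho n δ μ ^ 2 - 1)

/-- The components of the scaled hard instance in dimension `m`. -/
def hardF (n m : ℕ) (δ μ Δ : ℝ) (k : Fin n) (x : Vec m) : ℝ :=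
  hardLambda n δ μ Δ *
    hardR n m (hardZeta n δ μ) (hardC n δ μ) k ((hardBeta n δ μ Δ)⁻¹ • x)

/-- The dimension of the hard instance. -/
def hardDim (n : ℕ) (δ μ Δ ε : ℝ) : ℕ :=
  ⌊Real.log (Δ / (9 * ε)) / (2 * Real.log (1 / hardQ n δ μ)) + 2⌋₊

end

/-! The components form a chain. Each row of the bidiagonal matrix couples two neighbouring
coordinates, consecutive rows belong to different clients, and the master holds only the linear term
on the first coordinate. From a vector supported on the first `k` coordinates, only the owner
`rowNode n hn k` of the row joining coordinates `k - 1` and `k` can make coordinate `k` nonzero;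
gradients and proximal points of all other nodes stay in `prefixSpace m k` (`pifo_quadComp_subset`).

Hence the reached coordinates are bounded pointwise by a counter, `level` (`I_le_level`). A round
raises it by one if the sampled client is the single useful one, and by two if the anchor is
updated. The useful client depends only on past draws, so the two events have probability at most
`q₀ / n` and `c₀ / n`, and the expected level after `T` rounds is at most `1 + T * ((q₀ + 2 * c₀) /
n)`. The iterates may depend on the random outcome in any way, since only the counter is analysed.

The minimizer of `f` is a geometric vector of ratio `q`, and on the first `k` coordinates the excess
of `f` is at least `Δ * q ^ (2 * k)` (`le_avgFun_quadComp_sub`). With `M` about `log (Δ / (9 ε)) /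
(2 log (1 / q))` this is at least `9 ε` at level `M`. An expected error below `ε` therefore forces
level above `M` with probability more than `8 / 9`, and Markov's inequality makes `T` at least of
order `n * M` (`rounds_lower_bound`). Each round costs at least two transmissions and the
initialization `2 (n - 1)`. Estimating `log (1 / q)` in the two regimes (`rate_of_large`,
`rate_of_small`) gives the stated bounds. -/

noncomputable section

open scoped InnerProductSpace

/-! ### Rows, components and their average. -/

/-- The coordinates of `x`, continued by zero. -/
def zeroExt {m : ℕ} (x : Vec m) (s : ℕ) : ℝ := if h : s < m then x ⟨s, h⟩ else 0

lemma zeroExt_val {m : ℕ} (x : Vec m) (s : Fin m) : zeroExt x s = x s := by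
  simp [zeroExt]

lemma zeroExt_of_le {m : ℕ} (x : Vec m) {s : ℕ} (h : m ≤ s) : zeroExt x s = 0 := by
  simp [zeroExt, Nat.not_lt.mpr h]

lemma zeroExt_sub {m : ℕ} (x y : Vec m) (s : ℕ) :
    zeroExt (x - y) s = zeroExt x s - zeroExt y s := by
  by_cases h : s < m <;> simp [zeroExt, h]

lemma zeroExt_smul {m : ℕ} (a : ℝ) (x : Vec m) (s : ℕ) :
    zeroExt (a • x) s = a * zeroExt x s := by
  by_cases h : s < m <;> simp [zeroExt, h]

/-- The `l`-th row of `hardB` as a vector. -/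
def bidiagRow (m : ℕ) (ζ : ℝ) (l : Fin m) : Vec m := WithLp.toLp 2 (hardB m ζ l)

lemma inner_bidiagRow {m : ℕ} (ζ : ℝ) (l : Fin m) (x : Vec m) :
    ⟪bidiagRow m ζ l, x⟫_ℝ = ∑ s, hardB m ζ l s * x s := by
  simp [bidiagRow, PiLp.inner_apply, mul_comm]

lemma inner_bidiagRow_eq {m : ℕ} (ζ : ℝ) (l : Fin m) (x : Vec m) :
    ⟪bidiagRow m ζ l, x⟫_ℝ = (if (l : ℕ) + 1 = m then ζ else 1) * x l - zeroExt x (l + 1) := by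
  rw [inner_bidiagRow]
  have hs : ∀ s : Fin m, hardB m ζ l s * x s =
      (if s = l then (if (l : ℕ) + 1 = m then ζ else 1) * x l else 0) -
        (if (s : ℕ) = l + 1 then x s else 0) := by
    intro s
    by_cases h : s = l
    · subst h; simp [hardB]
    · by_cases h' : (s : ℕ) = l + 1 <;> simp [hardB, h, h']
  rw [Finset.sum_congr rfl fun s _ => hs s, Finset.sum_sub_distrib]
  congr 1
  · simp
  · by_cases h : (l : ℕ) + 1 < m
    · rw [Finset.sum_eq_single (⟨l + 1, h⟩ : Fin m)]
      · simp [zeroExt, h]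
      · intro b _ hb
        rw [if_neg]
        intro h'
        exact hb (Fin.ext h')
      · simp
    · rw [zeroExt_of_le x (by omega)]
      refine Finset.sum_eq_zero fun s _ => ?_
      rw [if_neg]
      have := s.2
      omega

/-- The quadratic component functions, parametrized by their coefficients. -/
def quadComp (n m : ℕ) (ζ c θ η : ℝ) (k : Fin n) (x : Vec m) : ℝ :=
  θ * ((n : ℝ) / 2 * ∑ l ∈ hardRows n m k, ⟪bidiagRow m ζ l, x⟫_ℝ ^ 2 + c / 2 * ‖x‖ ^ 2) -
    η * (if (k : ℕ) = 0 then n * zeroExt x 0 else 0)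

lemma hardRows_of_eq_zero {n m : ℕ} {k : Fin n} (hk : (k : ℕ) = 0) : hardRows n m k = ∅ := by
  simp [hardRows, hk]

/-- Absorbs the scaling into `θ = λ / β²` and `η = λ / β`. Most of what follows then needs only a
few algebraic relations among the coefficients. -/
lemma hardF_eq_quadComp (n m : ℕ) (δ μ Δ : ℝ) :
    hardF n m δ μ Δ = quadComp n m (hardZeta n δ μ) (hardC n δ μ)
      (hardLambda n δ μ Δ * (hardBeta n δ μ Δ)⁻¹ ^ 2)
      (hardLambda n δ μ Δ * (hardBeta n δ μ Δ)⁻¹) := by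
  funext k x
  have hn : ‖(hardBeta n δ μ Δ)⁻¹ • x‖ ^ 2 = (hardBeta n δ μ Δ)⁻¹ ^ 2 * ‖x‖ ^ 2 := by
    rw [norm_smul, mul_pow, Real.norm_eq_abs, sq_abs]
  unfold hardF hardR quadComp
  by_cases hk : (k : ℕ) = 0
  · rw [if_pos hk, if_pos hk, hardRows_of_eq_zero hk, hn]
    change _ * (_ - n * zeroExt ((hardBeta n δ μ Δ)⁻¹ • x) 0) = _
    rw [zeroExt_smul, Finset.sum_empty]
    ring
  · rw [if_neg hk, if_neg hk, hn]
    simp only [← inner_bidiagRow, inner_smul_right, mul_pow]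
    rw [← Finset.mul_sum]
    ring

/-- The node that owns the row joining the coordinates `k - 1` and `k`. -/
def rowNode (n : ℕ) (hn : 3 ≤ n) (k : ℕ) : Fin n :=
  ⟨(k - 1) % (n - 1) + 1, by have := Nat.mod_lt (k - 1) (show 0 < n - 1 by omega); omega⟩

lemma mem_hardRows_iff {n m : ℕ} (hn : 3 ≤ n) (k : Fin n) (l : Fin m) :
    l ∈ hardRows n m k ↔ k = rowNode n hn (l + 1) := by
  simp only [hardRows, Finset.mem_filter, Finset.mem_univ, true_and, rowNode, Fin.ext_iff,
    Nat.add_sub_cancel]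
  have hk := k.2
  constructor
  · rintro ⟨h0, h⟩
    have h' : (l : ℕ) ≡ k - 1 [MOD (n - 1)] := by
      apply Nat.ModEq.add_right_cancel' 1
      rwa [Nat.sub_add_cancel (by omega)]
    have h2 : ((k : ℕ) - 1) % (n - 1) = k - 1 := Nat.mod_eq_of_lt (by omega)
    have : (l : ℕ) % (n - 1) = k - 1 := by rw [← h2]; exact h'
    omega
  · intro h
    refine ⟨by omega, ?_⟩
    rw [h]
    exact ((Nat.mod_modEq _ _).add_right 1).symm

lemma sum_hardRows {n m : ℕ} (hn : 3 ≤ n) (g : Fin m → ℝ) :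
    ∑ k : Fin n, ∑ l ∈ hardRows n m k, g l = ∑ l, g l := by
  have : ∀ k : Fin n, ∑ l ∈ hardRows n m k, g l =
      ∑ l : Fin m, if k = rowNode n hn (l + 1) then g l else 0 := by
    intro k
    rw [← Finset.sum_filter]
    congr 1
    ext l
    simp [mem_hardRows_iff hn]
  simp_rw [this]
  rw [Finset.sum_comm]
  simp

lemma avgFun_quadComp {n m : ℕ} (hn : 3 ≤ n) (ζ c θ η : ℝ) (x : Vec m) :
    avgFun (quadComp n m ζ c θ η) x =
      θ * (1 / 2 * ∑ l, ⟪bidiagRow m ζ l, x⟫_ℝ ^ 2 + c / 2 * ‖x‖ ^ 2) - η * zeroExt x 0 := by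
  have hn0 : (n : ℝ) ≠ 0 := by positivity
  have h1 : ∑ k : Fin n, (if (k : ℕ) = 0 then (n : ℝ) * zeroExt x 0 else 0) = n * zeroExt x 0 := by
    rw [Finset.sum_eq_single (⟨0, Nat.zero_lt_of_lt hn⟩ : Fin n)]
    · simp
    · intro b _ hb
      rw [if_neg]
      intro h
      exact hb (Fin.ext h)
    · simp
  unfold avgFun quadComp
  rw [Finset.sum_sub_distrib, ← Finset.mul_sum, ← Finset.mul_sum, h1, Finset.sum_add_distrib,
    ← Finset.mul_sum, sum_hardRows hn]
  simp only [Finset.sum_const, Finset.card_univ, Fintype.card_fin, nsmul_eq_mul]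
  field_simp

/-! ### Strong convexity, the minimizer, and the excess on prefix subspaces. -/

lemma strongConvexOn_avgFun_quadComp {n m : ℕ} (hn : 3 ≤ n) {ζ c θ η μ : ℝ} (hθ : 0 ≤ θ)
    (hμ : θ * c = μ) : StrongConvexOn Set.univ μ (avgFun (quadComp n m ζ c θ η)) := by
  rw [strongConvexOn_iff_convex]
  have h : (fun x => avgFun (quadComp n m ζ c θ η) x - μ / 2 * ‖x‖ ^ 2) =
      fun x : Vec m => (∑ l, (θ / 2) * ⟪bidiagRow m ζ l, x⟫_ℝ ^ 2) + (-η) * zeroExt x 0 := by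
    funext x
    rw [avgFun_quadComp hn, ← hμ, ← Finset.mul_sum]
    ring
  rw [h]
  have hsum : ∀ t : Finset (Fin m), ConvexOn ℝ Set.univ
      (fun x : Vec m => ∑ l ∈ t, (θ / 2) * ⟪bidiagRow m ζ l, x⟫_ℝ ^ 2) := by
    intro t
    induction t using Finset.induction_on with
    | empty => simpa using convexOn_const (0 : ℝ) (convex_univ (𝕜 := ℝ) (E := Vec m))
    | insert a t ha ih =>
      simp only [Finset.sum_insert ha]
      refine ConvexOn.add ?_ ih
      have h2 : ConvexOn ℝ Set.univ (fun y : ℝ => y ^ 2) := even_two.convexOn_pow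
      exact (h2.comp_linearMap (innerSL ℝ (bidiagRow m ζ a)).toLinearMap).smul
        (by positivity : 0 ≤ θ / 2)
  refine (hsum _).add ?_
  refine ⟨convex_univ, fun x _ y _ a b _ _ _ => le_of_eq ?_⟩
  have : zeroExt (a • x + b • y) 0 = a * zeroExt x 0 + b * zeroExt y 0 := by
    have h3 := zeroExt_sub (a • x) ((-b) • y) 0
    rw [zeroExt_smul, zeroExt_smul] at h3
    rw [show a • x + b • y = a • x - (-b) • y by simp, h3]
    ring
  simp only [this, smul_eq_mul]
  ring

/-- The vector with coordinates `a * q ^ (s + 1)`. -/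
def geomVec (m : ℕ) (a q : ℝ) : Vec m := WithLp.toLp 2 fun s => a * q ^ ((s : ℕ) + 1)

/-- The stationarity equation in weak form, row by row. `hc` says that `q` is a root of the
three-term recurrence `1 + q² = (2 + c) q`, and `hζ` is the boundary condition that lets the last
row fit the same pattern. The right side telescopes when summed. -/
lemma row_geomVec {m : ℕ} {ζ c q a : ℝ} (hζ : ζ ^ 2 = 1 - q) (hc : c * q = (1 - q) ^ 2)
    (l : Fin m) (v : Vec m) :
    ⟪bidiagRow m ζ l, geomVec m a q⟫_ℝ * ⟪bidiagRow m ζ l, v⟫_ℝ + c * (geomVec m a q l * v l) =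
      a * (1 - q) * (q ^ (l : ℕ) * zeroExt v l - q ^ ((l : ℕ) + 1) * zeroExt v (l + 1)) := by
  rw [inner_bidiagRow_eq, inner_bidiagRow_eq, zeroExt_val]
  have hl := l.2
  have hg : geomVec m a q l = a * q ^ ((l : ℕ) + 1) := rfl
  rw [hg]
  by_cases h : (l : ℕ) + 1 = m
  · rw [if_pos h, zeroExt_of_le _ h.ge, zeroExt_of_le _ h.ge]
    linear_combination (a * q ^ ((l : ℕ) + 1) * v l) * hζ + (a * q ^ (l : ℕ) * v l) * hc
  · have h2 : zeroExt (geomVec m a q) (l + 1) = a * q ^ ((l : ℕ) + 1 + 1) := by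
      rw [zeroExt, dif_pos (by omega)]
      rfl
    rw [if_neg h, h2]
    linear_combination (a * q ^ (l : ℕ) * v l) * hc

lemma sum_ge_telescope {m : ℕ} (g : ℕ → ℝ) (hg : g m = 0) {k : ℕ} (hk : k ≤ m) :
    ∑ l : Fin m, (if k ≤ (l : ℕ) then g l - g (l + 1) else 0) = g k := by
  rw [Fin.sum_univ_eq_sum_range (fun l => if k ≤ l then g l - g (l + 1) else 0) m,
    ← Finset.sum_filter]
  have : (Finset.range m).filter (fun l => k ≤ l) = Finset.Ico k m := by
    ext; simp; tauto
  rw [this, Finset.sum_Ico_eq_sum_range]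
  have h3 := Finset.sum_range_sub' (fun i => g (k + i)) (m - k)
  simp only [add_zero, Nat.add_sub_cancel' hk, hg, sub_zero] at h3
  simpa [add_assoc] using h3

lemma avgFun_quadComp_sub {n m : ℕ} (hn : 3 ≤ n) {ζ c θ η q a : ℝ}
    (hζ : ζ ^ 2 = 1 - q) (hc : c * q = (1 - q) ^ 2) (ha : θ * (a * (1 - q)) = η) (x : Vec m) :
    avgFun (quadComp n m ζ c θ η) x - avgFun (quadComp n m ζ c θ η) (geomVec m a q) =
      θ / 2 * ∑ l, (⟪bidiagRow m ζ l, x - geomVec m a q⟫_ℝ ^ 2 +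
        c * (x - geomVec m a q) l ^ 2) := by
  set z := geomVec m a q with hz
  -- The first-order condition tested on `x - z`. Only coordinate `0` survives the telescoping, and
  -- `ha` matches it with the linear term of the objective.
  have key : ∑ l, (⟪bidiagRow m ζ l, z⟫_ℝ * ⟪bidiagRow m ζ l, x - z⟫_ℝ +
      c * (z l * (x - z) l)) = a * (1 - q) * zeroExt (x - z) 0 := by
    rw [Finset.sum_congr rfl fun l _ => row_geomVec hζ hc l (x - z), ← Finset.mul_sum]
    congr 1
    have := sum_ge_telescope (m := m) (fun s => q ^ s * zeroExt (x - z) s)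
      (by simp [zeroExt_of_le]) (Nat.zero_le m)
    simpa using this
  rw [zeroExt_sub] at key
  rw [avgFun_quadComp hn, avgFun_quadComp hn, ← ha]
  have e1 : ∑ l, (⟪bidiagRow m ζ l, x - z⟫_ℝ ^ 2 + c * (x - z) l ^ 2) =
      ∑ l, (⟪bidiagRow m ζ l, x⟫_ℝ ^ 2 + c * x l ^ 2) -
      ∑ l, (⟪bidiagRow m ζ l, z⟫_ℝ ^ 2 + c * z l ^ 2) -
      2 * ∑ l, (⟪bidiagRow m ζ l, z⟫_ℝ * ⟪bidiagRow m ζ l, x - z⟫_ℝ +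
      c * (z l * (x - z) l)) := by
    rw [Finset.mul_sum, ← Finset.sum_sub_distrib, ← Finset.sum_sub_distrib]
    refine Finset.sum_congr rfl fun l _ => ?_
    rw [inner_sub_right, PiLp.sub_apply]
    ring
  rw [e1, key]
  simp only [EuclideanSpace.norm_sq_eq, Real.norm_eq_abs, sq_abs, Finset.sum_add_distrib,
    ← Finset.mul_sum]
  ring

lemma isMinOn_geomVec {n m : ℕ} (hn : 3 ≤ n) {ζ c θ η q a : ℝ}
    (hζ : ζ ^ 2 = 1 - q) (hc : c * q = (1 - q) ^ 2) (ha : θ * (a * (1 - q)) = η)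
    (hθ : 0 ≤ θ) (hc0 : 0 ≤ c) :
    IsMinOn (avgFun (quadComp n m ζ c θ η)) Set.univ (geomVec m a q) := by
  intro x _
  have h := avgFun_quadComp_sub (m := m) hn hζ hc ha x
  have : 0 ≤ θ / 2 * ∑ l, (⟪bidiagRow m ζ l, x - geomVec m a q⟫_ℝ ^ 2 +
        c * (x - geomVec m a q) l ^ 2) := by positivity
  simp only [Set.mem_ofPred_eq]
  linarith

/-- The vectors whose coordinates from `k` on vanish. -/
def prefixSpace (m k : ℕ) : Submodule ℝ (Vec m) where
  carrier := {x | ∀ s : Fin m, k ≤ s → x s = 0}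
  add_mem' := fun hx hy s hs => by simp [hx s hs, hy s hs]
  zero_mem' := fun s _ => rfl
  smul_mem' := fun a x hx s hs => by simp [hx s hs]

lemma prefixSpace_mono {m k k' : ℕ} (h : k ≤ k') : prefixSpace m k ≤ prefixSpace m k' :=
  fun _ hx s hs => hx s (h.trans hs)

lemma zeroExt_of_mem_prefixSpace {m k : ℕ} {x : Vec m} (hx : x ∈ prefixSpace m k) {s : ℕ}
    (hs : k ≤ s) : zeroExt x s = 0 := by
  unfold zeroExt
  split_ifs with h
  · exact hx ⟨s, h⟩ hs
  · rfl

/-- `row_geomVec` with the geometric vector as its own test vector, telescoped from `k` on. -/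
lemma sum_ge_geomVec {m : ℕ} {ζ c q a : ℝ} (hζ : ζ ^ 2 = 1 - q) (hc : c * q = (1 - q) ^ 2)
    {k : ℕ} (hk : k < m) :
    ∑ l : Fin m, (if k ≤ (l : ℕ) then ⟪bidiagRow m ζ l, geomVec m a q⟫_ℝ ^ 2 +
      c * geomVec m a q l ^ 2 else 0) = a ^ 2 * (1 - q) * q ^ (2 * k + 1) := by
  have h1 := sum_ge_telescope (m := m)
    (fun s => a * (1 - q) * (q ^ s * zeroExt (geomVec m a q) s))
    (by simp [zeroExt_of_le]) hk.le
  have h2 : zeroExt (geomVec m a q) k = a * q ^ (k + 1) := by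
    rw [zeroExt, dif_pos hk]; rfl
  rw [h2] at h1
  rw [show a ^ 2 * (1 - q) * q ^ (2 * k + 1) = a * (1 - q) * (q ^ k * (a * q ^ (k + 1))) by ring,
    ← h1]
  refine Finset.sum_congr rfl fun l _ => ?_
  rw [← mul_sub, ← row_geomVec hζ hc, sq, sq]

/-- Rows `l ≥ k` see only coordinates where `x` vanishes, so their share of the excess is that of
the minimizer alone. The remaining shares are nonnegative and are dropped. -/
lemma le_avgFun_quadComp_sub {n m : ℕ} (hn : 3 ≤ n) {ζ c θ η q a : ℝ}
    (hζ : ζ ^ 2 = 1 - q) (hc : c * q = (1 - q) ^ 2) (ha : θ * (a * (1 - q)) = η)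
    (hθ : 0 ≤ θ) (hc0 : 0 ≤ c) {k : ℕ} (hk : k < m) {x : Vec m} (hx : x ∈ prefixSpace m k) :
    θ / 2 * (a ^ 2 * (1 - q) * q ^ (2 * k + 1)) ≤
      avgFun (quadComp n m ζ c θ η) x - avgFun (quadComp n m ζ c θ η) (geomVec m a q) := by
  rw [avgFun_quadComp_sub hn hζ hc ha, ← sum_ge_geomVec hζ hc hk]
  refine mul_le_mul_of_nonneg_left (Finset.sum_le_sum fun l _ => ?_) (by positivity)
  split_ifs with h
  · rw [inner_sub_right, inner_bidiagRow_eq ζ l x, zeroExt_of_mem_prefixSpace hx (by omega),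
      PiLp.sub_apply, hx l h]
    simp
  · positivity

lemma avgFun_quadComp_zero_sub {n m : ℕ} (hn : 3 ≤ n) {ζ c θ η q a : ℝ}
    (hζ : ζ ^ 2 = 1 - q) (hc : c * q = (1 - q) ^ 2) (ha : θ * (a * (1 - q)) = η)
    (hm : 0 < m) :
    avgFun (quadComp n m ζ c θ η) 0 - avgFun (quadComp n m ζ c θ η) (geomVec m a q) =
      θ / 2 * (a ^ 2 * (1 - q) * q) := by
  have h := sum_ge_geomVec (m := m) (a := a) hζ hc hm
  simp only [Nat.zero_le, if_true, mul_zero, zero_add, pow_one] at h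
  rw [avgFun_quadComp_sub hn hζ hc ha, ← h]
  simp

/-! ### Gradients and average second-order similarity. -/

/-- The first basis vector (zero in dimension zero). -/
def firstVec (m : ℕ) : Vec m := WithLp.toLp 2 fun s => if (s : ℕ) = 0 then 1 else 0

lemma inner_firstVec {m : ℕ} (x : Vec m) : ⟪firstVec m, x⟫_ℝ = zeroExt x 0 := by
  simp only [firstVec, PiLp.inner_apply, zeroExt]
  split_ifs with h
  · rw [Finset.sum_eq_single (⟨0, h⟩ : Fin m)]
    · simp
    · intro b _ hb
      have : (b : ℕ) ≠ 0 := fun h' => hb (Fin.ext h')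
      simp [this]
    · simp
  · refine Finset.sum_eq_zero fun s _ => ?_
    have := s.2
    omega

/-- The gradient of `quadComp`. -/
def quadGrad (n m : ℕ) (ζ c θ η : ℝ) (k : Fin n) (x : Vec m) : Vec m :=
  θ • ((n : ℝ) • ∑ l ∈ hardRows n m k, ⟪bidiagRow m ζ l, x⟫_ℝ • bidiagRow m ζ l + c • x) -
    (η * if (k : ℕ) = 0 then (n : ℝ) else 0) • firstVec m

lemma hasGradientAt_quadComp {n m : ℕ} (ζ c θ η : ℝ) (k : Fin n) (x : Vec m) :
    HasGradientAt (quadComp n m ζ c θ η k) (quadGrad n m ζ c θ η k x) x := by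
  rw [hasGradientAt_iff_hasFDerivAt]
  have hb : ∀ b : Vec m, HasFDerivAt (fun x : Vec m => ⟪b, x⟫_ℝ ^ 2)
      ((2 * ⟪b, x⟫_ℝ) • innerSL ℝ b) x := by
    intro b
    simpa using (innerSL ℝ b).hasFDerivAt (x := x).pow 2
  have hs := HasFDerivAt.fun_sum (u := hardRows n m k) (fun l _ => hb (bidiagRow m ζ l))
  have hn := (hasStrictFDerivAt_norm_sq x).hasFDerivAt
  have he := (innerSL ℝ (firstVec m)).hasFDerivAt (x := x)
  have h := (((hs.const_mul ((n : ℝ) / 2)).add (hn.const_mul (c / 2))).const_mul θ).sub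
    (he.const_mul (η * if (k : ℕ) = 0 then (n : ℝ) else 0))
  have hf : (fun y : Vec m => θ * ((n : ℝ) / 2 * ∑ l ∈ hardRows n m k, ⟪bidiagRow m ζ l, y⟫_ℝ ^ 2 +
      c / 2 * ‖y‖ ^ 2) - (η * if (k : ℕ) = 0 then (n : ℝ) else 0) * innerSL ℝ (firstVec m) y) =
      quadComp n m ζ c θ η k := by
    funext y
    rw [innerSL_apply_apply, inner_firstVec]
    unfold quadComp
    split_ifs <;> ring
  rw [← hf]
  refine h.congr_fderiv ?_
  ext v
  simp only [quadGrad, InnerProductSpace.toDual_apply_apply, inner_sub_left, inner_add_left,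
    real_inner_smul_left, sum_inner, sub_apply,
    add_apply, smul_apply, sum_apply, innerSL_apply_apply, smul_eq_mul, nsmul_eq_mul]
  rw [Finset.mul_sum, Finset.mul_sum]
  congr 1
  congr 1
  congr 1
  · refine Finset.sum_congr rfl fun l _ => ?_
    ring
  · simp
    ring

lemma gradient_sub_avgFun {n d : ℕ} {f : Fin n → Vec d → ℝ} {g : Fin n → Vec d → Vec d}
    (h : ∀ i x, HasGradientAt (f i) (g i x) x) (i : Fin n) (x : Vec d) :
    gradient (fun z => f i z - avgFun f z) x = g i x - (1 / (n : ℝ)) • ∑ k, g k x := by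
  apply HasGradientAt.gradient
  rw [hasGradientAt_iff_hasFDerivAt]
  have h' : ∀ i, HasFDerivAt (f i) (InnerProductSpace.toDual ℝ (Vec d) (g i x)) x :=
    fun i => hasGradientAt_iff_hasFDerivAt.mp (h i x)
  have hs := (h' i).sub ((HasFDerivAt.fun_sum (u := Finset.univ)
    (fun k _ => h' k)).const_mul (1 / (n : ℝ)))
  refine hs.congr_fderiv ?_
  simp only [map_sub, map_sum, map_smulₛₗ, one_div]
  simp

/-- Variance is at most the second moment. -/
lemma sum_norm_sub_mean_sq_le {n : ℕ} {E : Type*} [NormedAddCommGroup E] [InnerProductSpace ℝ E]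
    (u : Fin n → E) :
    ∑ i, ‖u i - (1 / (n : ℝ)) • ∑ k, u k‖ ^ 2 ≤ ∑ i, ‖u i‖ ^ 2 := by
  rcases Nat.eq_zero_or_pos n with hn | hn
  · subst hn; simp
  have hn0 : (n : ℝ) ≠ 0 := by positivity
  set a := (1 / (n : ℝ)) • ∑ k, u k with ha
  have hsum : ∑ k, u k = (n : ℝ) • a := by
    rw [ha, smul_smul, mul_one_div_cancel hn0, one_smul]
  simp only [norm_sub_sq_real]
  rw [Finset.sum_add_distrib, Finset.sum_sub_distrib, ← Finset.mul_sum, ← sum_inner, hsum,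
    real_inner_smul_left, real_inner_self_eq_norm_sq]
  simp only [Finset.sum_const, Finset.card_univ, Fintype.card_fin, nsmul_eq_mul]
  have : 0 ≤ (n : ℝ) * ‖a‖ ^ 2 := by positivity
  linarith

lemma norm_sum_smul_sq_of_orthogonal {ι E : Type*} [NormedAddCommGroup E] [InnerProductSpace ℝ E]
    (s : Finset ι) (r : ι → ℝ) (b : ι → E)
    (h : ∀ i ∈ s, ∀ j ∈ s, i ≠ j → ⟪b i, b j⟫_ℝ = 0) :
    ‖∑ i ∈ s, r i • b i‖ ^ 2 = ∑ i ∈ s, r i ^ 2 * ‖b i‖ ^ 2 := by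
  rw [← real_inner_self_eq_norm_sq, sum_inner]
  refine Finset.sum_congr rfl fun i hi => ?_
  rw [inner_sum, Finset.sum_eq_single i]
  · rw [real_inner_smul_left, real_inner_smul_right, real_inner_self_eq_norm_sq]
    ring
  · intro j hj hji
    rw [real_inner_smul_left, real_inner_smul_right, h i hi j hj hji.symm]
    ring
  · intro h; exact absurd hi h

lemma bidiagRow_apply {m : ℕ} (ζ : ℝ) (l k : Fin m) : bidiagRow m ζ l k = hardB m ζ l k := rfl

lemma hardB_eq_zero {m : ℕ} {ζ : ℝ} {l k : Fin m} (h1 : (k : ℕ) ≠ l) (h2 : (k : ℕ) ≠ l + 1) :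
    hardB m ζ l k = 0 := by
  have : k ≠ l := fun h => h1 (congrArg Fin.val h)
  simp [hardB, this, h2]

/-- Here `n ≥ 3` enters: the modulus `n - 1` is at least `2`, so no client owns two consecutive
rows. Both the orthogonality within a client and the one-level gain per oracle call rest on this. -/
lemma rowNode_ne_succ {n : ℕ} (hn : 3 ≤ n) {k : ℕ} (hk : 1 ≤ k) :
    rowNode n hn k ≠ rowNode n hn (k + 1) := by
  obtain ⟨k, rfl⟩ := Nat.exists_eq_add_of_le' hk
  intro h
  simp only [rowNode, Fin.ext_iff, Nat.add_sub_cancel] at h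
  have h1 : k ≡ k + 1 [MOD (n - 1)] := by
    unfold Nat.ModEq; omega
  have h2 : 0 ≡ 1 [MOD (n - 1)] := Nat.ModEq.add_left_cancel' k h1
  have h3 := (Nat.modEq_iff_dvd' (by omega : 0 ≤ 1)).mp h2
  have := Nat.le_of_dvd (by omega) h3
  omega

lemma inner_bidiagRow_of_mem_hardRows {n m : ℕ} (hn : 3 ≤ n) (ζ : ℝ) {k : Fin n} {l l' : Fin m}
    (hl : l ∈ hardRows n m k) (hl' : l' ∈ hardRows n m k) (h : l ≠ l') :
    ⟪bidiagRow m ζ l, bidiagRow m ζ l'⟫_ℝ = 0 := by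
  rw [mem_hardRows_iff hn] at hl hl'
  have h0 : (l : ℕ) ≠ l' := fun h' => h (Fin.ext h')
  have h1 : (l : ℕ) + 1 ≠ l' := fun h' =>
    rowNode_ne_succ hn (Nat.le_add_left 1 l) (by rw [h', ← hl', hl, h'])
  have h2 : (l' : ℕ) + 1 ≠ l := fun h' =>
    rowNode_ne_succ hn (Nat.le_add_left 1 l') (by rw [h', ← hl, hl', h'])
  rw [inner_bidiagRow]
  refine Finset.sum_eq_zero fun s _ => ?_
  rw [bidiagRow_apply]
  by_cases hs : (s : ℕ) = l ∨ (s : ℕ) = l + 1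
  · rw [hardB_eq_zero (l := l') (by omega) (by omega), mul_zero]
  · rw [hardB_eq_zero (l := l) (by omega) (by omega), zero_mul]

lemma norm_bidiagRow_sq_le {m : ℕ} {ζ : ℝ} (hζ : ζ ^ 2 ≤ 1) (l : Fin m) :
    ‖bidiagRow m ζ l‖ ^ 2 ≤ 2 := by
  rw [← real_inner_self_eq_norm_sq, inner_bidiagRow_eq]
  by_cases h : (l : ℕ) + 1 = m
  · rw [if_pos h, zeroExt_of_le _ h.ge]
    have : bidiagRow m ζ l l = ζ := by simp [bidiagRow, hardB, h]
    rw [this]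
    nlinarith
  · have h1 : (l : ℕ) + 1 < m := by have := l.2; omega
    have h2 : bidiagRow m ζ l l = 1 := by simp [bidiagRow, hardB, h]
    have h3 : zeroExt (bidiagRow m ζ l) (l + 1) = -1 := by
      rw [zeroExt, dif_pos h1, bidiagRow_apply]
      simp [hardB, Fin.ext_iff]
    rw [if_neg h, h2, h3]
    norm_num

lemma sum_inner_bidiagRow_sq_le {m : ℕ} {ζ : ℝ} (hζ : ζ ^ 2 ≤ 1) (v : Vec m) :
    ∑ l, ⟪bidiagRow m ζ l, v⟫_ℝ ^ 2 ≤ 4 * ‖v‖ ^ 2 := by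
  -- The bound `(s - t)² ≤ 2 s² + 2 t²`, written so that the shift from `l + 1` to `l` becomes a
  -- telescoping term.
  have h1 : ∀ l : Fin m, ⟪bidiagRow m ζ l, v⟫_ℝ ^ 2 ≤
      4 * v l ^ 2 - 2 * (zeroExt v l ^ 2 - zeroExt v (l + 1) ^ 2) := by
    intro l
    rw [inner_bidiagRow_eq, zeroExt_val]
    by_cases h : (l : ℕ) + 1 = m
    · rw [if_pos h, zeroExt_of_le _ h.ge]
      nlinarith [mul_nonneg (sub_nonneg.mpr hζ) (sq_nonneg (v l)), sq_nonneg (v l)]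
    · rw [if_neg h]
      nlinarith [sq_nonneg (v l + zeroExt v (l + 1))]
  refine (Finset.sum_le_sum fun l _ => h1 l).trans ?_
  have h2 := sum_ge_telescope (m := m) (fun s => zeroExt v s ^ 2)
    (by simp [zeroExt_of_le]) (Nat.zero_le m)
  simp only [Nat.zero_le, if_true] at h2
  rw [Finset.sum_sub_distrib, ← Finset.mul_sum, ← Finset.mul_sum, h2, EuclideanSpace.norm_sq_eq]
  simp only [Real.norm_eq_abs, sq_abs]
  nlinarith [sq_nonneg (zeroExt v 0)]

lemma quadGrad_sub {n m : ℕ} (ζ c θ η : ℝ) (k : Fin n) (x y : Vec m) :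
    quadGrad n m ζ c θ η k x - quadGrad n m ζ c θ η k y =
      (θ * n) • ∑ l ∈ hardRows n m k, ⟪bidiagRow m ζ l, x - y⟫_ℝ • bidiagRow m ζ l +
        (θ * c) • (x - y) := by
  simp only [quadGrad, inner_sub_right, sub_smul, Finset.sum_sub_distrib]
  module

/-- The common term `c / 2 * ‖x‖²` cancels in `f i - f`, and subtracting the mean only helps.
Orthogonality of a client's rows, `‖b_l‖² ≤ 2` and `∑ ⟪b_l, v⟫² ≤ 4 ‖v‖²` give the constant `8 n
θ²`, below `4 (2 n + 1) θ² = δ²`. -/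
lemma aveSS_quadComp {n m : ℕ} (hn : 3 ≤ n) {ζ c θ η δ : ℝ} (hζ : ζ ^ 2 ≤ 1)
    (hθ : θ ^ 2 * (4 * (2 * n + 1)) = δ ^ 2) : AveSS (quadComp n m ζ c θ η) δ := by
  have hg := fun k => hasGradientAt_quadComp (n := n) (m := m) ζ c θ η k
  refine ⟨fun i x => (hg i x).differentiableAt, fun x y => ?_⟩
  have hn0 : (0 : ℝ) < n := by positivity
  set u : Fin n → Vec m := fun k =>
    (θ * n) • ∑ l ∈ hardRows n m k, ⟪bidiagRow m ζ l, x - y⟫_ℝ • bidiagRow m ζ l with hu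
  have h1 : ∀ i, gradient (fun z => quadComp n m ζ c θ η i z - avgFun (quadComp n m ζ c θ η) z) x
      - gradient (fun z => quadComp n m ζ c θ η i z - avgFun (quadComp n m ζ c θ η) z) y =
      u i - (1 / (n : ℝ)) • ∑ k, u k := by
    intro i
    have h2 : ∀ k, quadGrad n m ζ c θ η k x =
        quadGrad n m ζ c θ η k y + (u k + (θ * c) • (x - y)) := by
      intro k
      rw [hu, ← quadGrad_sub]
      abel
    rw [gradient_sub_avgFun hg, gradient_sub_avgFun hg]
    simp only [h2]
    rw [Finset.sum_add_distrib, Finset.sum_add_distrib, Finset.sum_const, Finset.card_univ,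
      Fintype.card_fin, smul_add, smul_add, ← Nat.cast_smul_eq_nsmul ℝ n,
      smul_smul (1 / (n : ℝ)) (n : ℝ), one_div_mul_cancel hn0.ne', one_smul]
    abel
  simp only [h1]
  have h3 : ∀ k, ‖u k‖ ^ 2 ≤
      ∑ l ∈ hardRows n m k, θ ^ 2 * n ^ 2 * 2 * ⟪bidiagRow m ζ l, x - y⟫_ℝ ^ 2 := by
    intro k
    rw [hu]
    simp only
    rw [norm_smul, mul_pow, norm_sum_smul_sq_of_orthogonal _ _ _
      (fun i hi j hj hij => inner_bidiagRow_of_mem_hardRows hn ζ hi hj hij), Real.norm_eq_abs,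
      sq_abs, Finset.mul_sum]
    refine Finset.sum_le_sum fun l _ => ?_
    nlinarith [mul_le_mul_of_nonneg_left (norm_bidiagRow_sq_le hζ l)
      (by positivity : 0 ≤ (θ * n) ^ 2 * ⟪bidiagRow m ζ l, x - y⟫_ℝ ^ 2)]
  have h4 : ∑ k, ‖u k‖ ^ 2 ≤ θ ^ 2 * n ^ 2 * 2 * (4 * ‖x - y‖ ^ 2) := by
    refine (Finset.sum_le_sum fun k _ => h3 k).trans ?_
    rw [sum_hardRows hn, ← Finset.mul_sum]
    exact mul_le_mul_of_nonneg_left (sum_inner_bidiagRow_sq_le hζ _) (by positivity)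
  calc _ ≤ 1 / (n : ℝ) * (θ ^ 2 * n ^ 2 * 2 * (4 * ‖x - y‖ ^ 2)) :=
        mul_le_mul_of_nonneg_left ((sum_norm_sub_mean_sq_le u).trans h4) (by positivity)
    _ = θ ^ 2 * (8 * n) * ‖x - y‖ ^ 2 := by field_simp; ring
    _ ≤ δ ^ 2 * ‖x - y‖ ^ 2 := by
        rw [← hθ]
        exact mul_le_mul_of_nonneg_right
          (mul_le_mul_of_nonneg_left (by linarith) (sq_nonneg θ)) (sq_nonneg _)

/-! ### Oracle calls on prefix subspaces. -/

/-- The projection to `prefixSpace m k`. -/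
def truncVec {m : ℕ} (k : ℕ) (u : Vec m) : Vec m :=
  WithLp.toLp 2 fun s => if (s : ℕ) < k then u s else 0

lemma truncVec_apply {m : ℕ} (k : ℕ) (u : Vec m) (s : Fin m) :
    truncVec k u s = if (s : ℕ) < k then u s else 0 := rfl

lemma truncVec_mem {m : ℕ} (k : ℕ) (u : Vec m) : truncVec k u ∈ prefixSpace m k := by
  intro s hs
  rw [truncVec_apply, if_neg (by omega)]

lemma zeroExt_truncVec {m : ℕ} {k s : ℕ} (h : s < k) (u : Vec m) :
    zeroExt (truncVec k u) s = zeroExt u s := by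
  by_cases h' : s < m <;> simp [zeroExt, h', truncVec_apply, h]

lemma inner_bidiagRow_eq_zero {m k : ℕ} (ζ : ℝ) {l : Fin m} (hl : k ≤ l) {x : Vec m}
    (hx : x ∈ prefixSpace m k) : ⟪bidiagRow m ζ l, x⟫_ℝ = 0 := by
  rw [inner_bidiagRow_eq, hx l hl, zeroExt_of_mem_prefixSpace hx (by omega)]
  simp

lemma norm_sub_truncVec_sq {m k : ℕ} {x : Vec m} (hx : x ∈ prefixSpace m k) (u : Vec m) :
    ‖x - u‖ ^ 2 = ‖x - truncVec k u‖ ^ 2 + ‖u - truncVec k u‖ ^ 2 := by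
  simp only [EuclideanSpace.norm_sq_eq]
  rw [← Finset.sum_add_distrib]
  refine Finset.sum_congr rfl fun s _ => ?_
  simp only [PiLp.sub_apply, truncVec_apply, Real.norm_eq_abs, sq_abs]
  split_ifs with h
  · ring
  · rw [hx s (by omega)]
    ring

lemma row_ne_of_ne_rowNode {n m : ℕ} (hn : 3 ≤ n) {k : ℕ} {i : Fin n} (hi : i ≠ rowNode n hn k)
    {l : Fin m} (hl : l ∈ hardRows n m i) : (l : ℕ) + 1 ≠ k := by
  rintro rfl
  exact hi ((mem_hardRows_iff hn i l).mp hl)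

/-- Truncation at `k` leaves rows `l` with `l + 1 < k` unchanged and kills those with `l ≥ k`. Only
the straddling row `l + 1 = k` could grow, and `hi` excludes it. -/
lemma quadComp_truncVec_le {n m : ℕ} {ζ c θ η : ℝ} (hθ : 0 ≤ θ) (hc : 0 ≤ c)
    {k : ℕ} {i : Fin n} (hk : (i : ℕ) = 0 → 1 ≤ k)
    (hi : ∀ l ∈ hardRows n m i, (l : ℕ) + 1 ≠ k) (u : Vec m) :
    quadComp n m ζ c θ η i (truncVec k u) ≤ quadComp n m ζ c θ η i u := by
  unfold quadComp
  have hlin : (if (i : ℕ) = 0 then (n : ℝ) * zeroExt (truncVec k u) 0 else 0) =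
      if (i : ℕ) = 0 then (n : ℝ) * zeroExt u 0 else 0 := by
    split_ifs with h
    · rw [zeroExt_truncVec (hk h)]
    · rfl
  rw [hlin]
  have hnorm : ‖truncVec k u‖ ^ 2 ≤ ‖u‖ ^ 2 := by
    have := norm_sub_truncVec_sq (prefixSpace m k).zero_mem u
    simp only [zero_sub, norm_neg] at this
    nlinarith [sq_nonneg ‖u - truncVec k u‖]
  have hrow : ∀ l ∈ hardRows n m i,
      ⟪bidiagRow m ζ l, truncVec k u⟫_ℝ ^ 2 ≤ ⟪bidiagRow m ζ l, u⟫_ℝ ^ 2 := by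
    intro l hl
    have hlk := hi l hl
    rcases Nat.lt_or_ge l k with h | h
    · apply le_of_eq
      rw [inner_bidiagRow_eq, inner_bidiagRow_eq, zeroExt_truncVec (by omega), truncVec_apply,
        if_pos h]
    · rw [inner_bidiagRow_eq_zero ζ h (truncVec_mem k u), zero_pow two_ne_zero]
      exact sq_nonneg _
  have hsum := Finset.sum_le_sum hrow
  gcongr

lemma quadGrad_mem {n m : ℕ} (ζ c θ η : ℝ)
    {k : ℕ} {i : Fin n} (hk : (i : ℕ) = 0 → 1 ≤ k)
    (hi : ∀ l ∈ hardRows n m i, (l : ℕ) + 1 ≠ k) {x : Vec m}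
    (hx : x ∈ prefixSpace m k) : quadGrad n m ζ c θ η i x ∈ prefixSpace m k := by
  unfold quadGrad
  refine sub_mem (Submodule.smul_mem _ _ (add_mem (Submodule.smul_mem _ _
    (sum_mem fun l hl => ?_)) (Submodule.smul_mem _ _ hx))) ?_
  · have hlk := hi l hl
    rcases Nat.lt_or_ge l k with h | h
    · refine Submodule.smul_mem _ _ fun s hs => ?_
      rw [bidiagRow_apply, hardB_eq_zero (by omega) (by omega)]
    · rw [inner_bidiagRow_eq_zero ζ h hx, zero_smul]
      exact zero_mem _
  · split_ifs with h
    · refine Submodule.smul_mem _ _ fun s hs => ?_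
      have := hk h
      simp only [firstVec]
      rw [if_neg (by omega)]
    · rw [mul_zero, zero_smul]
      exact zero_mem _

/-- For a proximal point `u`, its truncation is a competitor with no larger component value and,
unless it equals `u`, strictly closer to `x`. The argument applies to every minimizer, so neither
existence nor uniqueness of the proximal point is needed. Level `k = 0` is allowed for clients,
which carry no linear term. -/
lemma pifo_quadComp_subset_of_row_ne {n m : ℕ} {ζ c θ η : ℝ} (hθ : 0 ≤ θ) (hc : 0 ≤ c)
    {k : ℕ} {i : Fin n} (hk : (i : ℕ) = 0 → 1 ≤ k)
    (hi : ∀ l ∈ hardRows n m i, (l : ℕ) + 1 ≠ k) {x : Vec m}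
    (hx : x ∈ prefixSpace m k) {γ : ℝ} (hγ : 0 < γ) :
    pifo (quadComp n m ζ c θ η i) γ x ⊆ prefixSpace m k := by
  rintro u (hu | hu)
  · rw [Set.mem_singleton_iff.mp hu, (hasGradientAt_quadComp ζ c θ η i x).gradient]
    exact quadGrad_mem ζ c θ η hk hi hx
  · have h1 : quadComp n m ζ c θ η i u + 1 / (2 * γ) * ‖x - u‖ ^ 2 ≤
        quadComp n m ζ c θ η i (truncVec k u) + 1 / (2 * γ) * ‖x - truncVec k u‖ ^ 2 :=
      hu (Set.mem_univ (truncVec k u))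
    have h2 := quadComp_truncVec_le (ζ := ζ) (η := η) hθ hc hk hi u
    rw [norm_sub_truncVec_sq hx u] at h1
    have h3 : 0 < 1 / (2 * γ) := by positivity
    have h4 : 1 / (2 * γ) * ‖u - truncVec k u‖ ^ 2 ≤ 0 := by nlinarith
    have h5 : ‖u - truncVec k u‖ ^ 2 ≤ 0 := by
      by_contra! h
      exact absurd (mul_pos h3 h) (not_lt.mpr h4)
    have h6 : u - truncVec k u = 0 := by
      rw [← norm_eq_zero]
      exact pow_eq_zero_iff two_ne_zero |>.mp (le_antisymm h5 (sq_nonneg _))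
    rw [sub_eq_zero.mp h6]
    exact truncVec_mem k u

lemma pifo_quadComp_subset {n m : ℕ} (hn : 3 ≤ n) {ζ c θ η : ℝ} (hθ : 0 ≤ θ) (hc : 0 ≤ c)
    {k : ℕ} (hk : 1 ≤ k) {i : Fin n} (hi : i ≠ rowNode n hn k) {x : Vec m}
    (hx : x ∈ prefixSpace m k) {γ : ℝ} (hγ : 0 < γ) :
    pifo (quadComp n m ζ c θ η i) γ x ⊆ prefixSpace m k :=
  pifo_quadComp_subset_of_row_ne hθ hc (fun _ => hk)
    (fun _ hl => row_ne_of_ne_rowNode hn hi hl) hx hγ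

lemma pifo_quadComp_zero_subset {n m : ℕ} {ζ c θ η : ℝ} (hθ : 0 ≤ θ) (hc : 0 ≤ c)
    {i : Fin n} (hi : (i : ℕ) ≠ 0) {γ : ℝ} (hγ : 0 < γ) :
    pifo (quadComp n m ζ c θ η i) γ 0 ⊆ prefixSpace m 0 :=
  pifo_quadComp_subset_of_row_ne hθ hc (fun h => absurd h hi)
    (fun _ _ => Nat.succ_ne_zero _) (zero_mem _) hγ

/-- The level that suffices after a call of the oracle of any node. -/
lemma pifo_quadComp_subset_succ {n m : ℕ} (hn : 3 ≤ n) {ζ c θ η : ℝ} (hθ : 0 ≤ θ) (hc : 0 ≤ c)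
    {k : ℕ} (hk : 1 ≤ k) (i : Fin n) {x : Vec m}
    (hx : x ∈ prefixSpace m k) {γ : ℝ} (hγ : 0 < γ) :
    pifo (quadComp n m ζ c θ η i) γ x ⊆ prefixSpace m (k + 1) := by
  -- The owner of the row entering coordinate `k` does not own the next row, so at level `k + 1` its
  -- oracle is already harmless.
  by_cases hi : i = rowNode n hn k
  · exact pifo_quadComp_subset hn hθ hc (by omega) (hi ▸ rowNode_ne_succ hn hk)
      (prefixSpace_mono (Nat.le_succ k) hx) hγ
  · exact (pifo_quadComp_subset hn hθ hc hk hi hx hγ).trans (prefixSpace_mono (Nat.le_succ k))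

lemma rowNode_ne_master {n : ℕ} (hn : 3 ≤ n) {i : Fin n} (hi : (i : ℕ) = 0) (k : ℕ) :
    rowNode n hn k ≠ i := by
  simp [rowNode, Fin.ext_iff, hi]

/-! ### The level process of a run. -/

namespace LooplessRun

variable {n d T : ℕ} {f : Fin n → Vec d → ℝ} {master : Fin n} {c₀ q₀ : ℝ} {x₀ : Vec d}
  {Ω : Type*} [MeasurableSpace Ω] {P : Measure Ω}

/-- A bound on the number of coordinates that are reached before round `t`, where `node k` is the
only node whose oracle can lead from level `k` to level `k + 1`. -/
def level (A : LooplessRun f master c₀ q₀ x₀ T P) (node : ℕ → Fin n) : ℕ → Ω → ℕ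
  | 0, _ => 1
  | t + 1, ω => if h : t < T then
      level A node t ω + (if A.i ⟨t, h⟩ ω = node (level A node t ω) then 1 else 0) +
        -- One unit for the extra client `j`, one for the calls of all nodes at the anchor. Both are
        -- granted unconditionally, so the level never depends on `j`.
        (if A.a ⟨t, h⟩ ω = true then 2 else 0)
    else level A node t ω

lemma level_succ (A : LooplessRun f master c₀ q₀ x₀ T P) (node : ℕ → Fin n) (t : Fin T) (ω : Ω) :
    A.level node (t + 1) ω = A.level node t ω +
      (if A.i t ω = node (A.level node t ω) then 1 else 0) +
        (if A.a t ω = true then 2 else 0) := by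
  rw [level, dif_pos t.2]

lemma one_le_level (A : LooplessRun f master c₀ q₀ x₀ T P) (node : ℕ → Fin n) (t : ℕ) (ω : Ω) :
    1 ≤ A.level node t ω := by
  induction t with
  | zero => simp [level]
  | succ t ih => rw [level]; split_ifs <;> omega

lemma level_le (A : LooplessRun f master c₀ q₀ x₀ T P) (node : ℕ → Fin n) (t : ℕ) (ω : Ω) :
    A.level node t ω ≤ 1 + 3 * t := by
  induction t with
  | zero => simp [level]
  | succ t ih => rw [level]; split_ifs <;> omega

/-- The σ-algebras of the random choices of a run. -/
abbrev sigmas (A : LooplessRun f master c₀ q₀ x₀ T P) : Fin T ⊕ Fin T ⊕ Fin T → MeasurableSpace Ω :=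
  Sum.elim (fun t : Fin T => MeasurableSpace.comap (A.i t) inferInstance)
    (Sum.elim (fun t : Fin T => MeasurableSpace.comap (A.j t) inferInstance)
      (fun t : Fin T => MeasurableSpace.comap (A.a t) inferInstance))

lemma sigmas_le (A : LooplessRun f master c₀ q₀ x₀ T P) (s : Fin T ⊕ Fin T ⊕ Fin T) :
    A.sigmas s ≤ ‹MeasurableSpace Ω› := by
  rcases s with t | t | t
  · exact (A.i_meas t).comap_le
  · exact (A.j_meas t).comap_le
  · exact (A.a_meas t).comap_le

/-- The indices of the sampled clients and coins before round `t`. -/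
def pastIdx (T t : ℕ) : Set (Fin T ⊕ Fin T ⊕ Fin T) :=
  {s | Sum.elim (fun u : Fin T => (u : ℕ) < t)
    (Sum.elim (fun _ => False) (fun u : Fin T => (u : ℕ) < t)) s}

lemma pastIdx_mono {t t' : ℕ} (h : t ≤ t') : pastIdx T t ⊆ pastIdx T t' := by
  rintro (u | u | u) hu
  · exact lt_of_lt_of_le hu h
  · exact hu
  · exact lt_of_lt_of_le hu h

/-- The level before round `t` is a function of earlier draws only, which makes it independent of
the client sampled in round `t`. No measurability of the iterates is involved. -/
lemma measurable_level_past (A : LooplessRun f master c₀ q₀ x₀ T P) (node : ℕ → Fin n) (t : ℕ) :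
    Measurable[⨆ s ∈ pastIdx T t, A.sigmas s] (A.level node t) := by
  induction t with
  | zero => exact @measurable_const _ _ _ (_) 1
  | succ t ih =>
    have hm : (⨆ s ∈ pastIdx T t, A.sigmas s) ≤ ⨆ s ∈ pastIdx T (t + 1), A.sigmas s :=
      biSup_mono fun s hs => pastIdx_mono (Nat.le_succ t) hs
    have ih' : Measurable[⨆ s ∈ pastIdx T (t + 1), A.sigmas s] (A.level node t) := ih.mono hm le_rfl
    by_cases h : t < T
    · have hi : Measurable[⨆ s ∈ pastIdx T (t + 1), A.sigmas s] (A.i ⟨t, h⟩) := by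
        refine Measurable.mono (comap_measurable _) ?_ le_rfl
        exact le_iSup₂_of_le (f := fun s (_ : s ∈ pastIdx T (t + 1)) => A.sigmas s)
          (Sum.inl ⟨t, h⟩) (Nat.lt_succ_self t) le_rfl
      have ha : Measurable[⨆ s ∈ pastIdx T (t + 1), A.sigmas s] (A.a ⟨t, h⟩) := by
        refine Measurable.mono (comap_measurable _) ?_ le_rfl
        exact le_iSup₂_of_le (f := fun s (_ : s ∈ pastIdx T (t + 1)) => A.sigmas s)
          (Sum.inr (Sum.inr ⟨t, h⟩)) (Nat.lt_succ_self t) le_rfl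
      have hg : Measurable (fun z : ℕ × Fin n × Bool =>
          z.1 + (if z.2.1 = node z.1 then 1 else 0) + (if z.2.2 = true then 2 else 0)) :=
        measurable_of_countable _
      have := hg.comp (ih'.prodMk (hi.prodMk ha))
      convert this using 1
      funext ω
      exact A.level_succ node ⟨t, h⟩ ω
    · convert ih' using 1
      funext ω
      rw [level, dif_neg h]

lemma measurable_level (A : LooplessRun f master c₀ q₀ x₀ T P) (node : ℕ → Fin n) (t : ℕ) :
    Measurable (A.level node t) :=
  (A.measurable_level_past node t).mono (iSup₂_le fun s _ => A.sigmas_le s) le_rfl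

lemma indep_past (A : LooplessRun f master c₀ q₀ x₀ T P) (t : Fin T) :
    Indep (⨆ s ∈ pastIdx T t, A.sigmas s) (MeasurableSpace.comap (A.i t) inferInstance) P := by
  have h := indep_iSup_of_disjoint (A.sigmas_le) A.indep
    (S := pastIdx T t) (T := {Sum.inl t}) (by
      rw [Set.disjoint_singleton_right]
      exact lt_irrefl (t : ℕ))
  have h2 : (⨆ s ∈ ({Sum.inl t} : Set (Fin T ⊕ Fin T ⊕ Fin T)), A.sigmas s) =
      MeasurableSpace.comap (A.i t) inferInstance := by
    rw [iSup_singleton]; rfl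
  rwa [h2] at h

/-- The target node is random, but given the value `k` of the level it is fixed, and by independence
it is drawn with probability `q (node k) ≤ q₀ / n`. Summing over the finitely many possible levels
gives the bound. -/
lemma measureReal_hit_le [IsProbabilityMeasure P] (A : LooplessRun f master c₀ q₀ x₀ T P)
    {node : ℕ → Fin n} (hnode : ∀ k, node k ≠ master) (t : Fin T) :
    P.real {ω | A.i t ω = node (A.level node t ω)} ≤ q₀ / n := by
  have hsub : {ω | A.i t ω = node (A.level node t ω)} ⊆ ⋃ k ∈ Finset.range (2 + 3 * t),
      (A.level node t ⁻¹' {k} ∩ A.i t ⁻¹' {node k}) := by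
    intro ω hω
    simp only [Set.mem_iUnion, Finset.mem_range]
    refine ⟨A.level node t ω, ?_, rfl, hω⟩
    have := A.level_le node t ω
    omega
  have hprod : ∀ k, P.real (A.level node t ⁻¹' {k} ∩ A.i t ⁻¹' {node k}) ≤
      q₀ / n * P.real (A.level node t ⁻¹' {k}) := by
    intro k
    have h := (Indep_iff _ _ P).mp (A.indep_past t) (A.level node t ⁻¹' {k})
      (A.i t ⁻¹' {node k}) (A.measurable_level_past node t (measurableSet_singleton k))
      ⟨{node k}, measurableSet_singleton _, rfl⟩
    have h2 : P.real (A.i t ⁻¹' {node k}) = A.q (node k) := A.i_law t (node k)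
    rw [measureReal_def, h, ENNReal.toReal_mul, ← measureReal_def, ← measureReal_def, h2, mul_comm]
    exact mul_le_mul_of_nonneg_right (A.q_le _ (hnode k)) measureReal_nonneg
  have hq : 0 ≤ q₀ / n := (A.q_pos _).le.trans (A.q_le _ (hnode 0))
  calc P.real {ω | A.i t ω = node (A.level node t ω)}
      ≤ P.real (⋃ k ∈ Finset.range (2 + 3 * t),
          (A.level node t ⁻¹' {k} ∩ A.i t ⁻¹' {node k})) :=
          measureReal_mono hsub (measure_ne_top P _)
    _ ≤ ∑ k ∈ Finset.range (2 + 3 * t),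
          P.real (A.level node t ⁻¹' {k} ∩ A.i t ⁻¹' {node k}) := measureReal_biUnion_finset_le _ _
    _ ≤ ∑ k ∈ Finset.range (2 + 3 * t), q₀ / n * P.real (A.level node t ⁻¹' {k}) :=
        Finset.sum_le_sum fun k _ => hprod k
    _ = q₀ / n * P.real (A.level node t ⁻¹' (Finset.range (2 + 3 * t))) := by
        rw [← Finset.mul_sum, sum_measureReal_preimage_singleton]
        exact fun y _ => A.measurable_level node t (measurableSet_singleton y)
    _ ≤ q₀ / n * 1 := mul_le_mul_of_nonneg_left measureReal_le_one hq
    _ = q₀ / n := mul_one _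

lemma integrable_level [IsProbabilityMeasure P] (A : LooplessRun f master c₀ q₀ x₀ T P)
    (node : ℕ → Fin n) (t : ℕ) : Integrable (fun ω => (A.level node t ω : ℝ)) P := by
  refine Integrable.of_bound
    (measurable_from_top.comp (A.measurable_level node t)).aestronglyMeasurable (1 + 3 * t)
    (Filter.Eventually.of_forall fun ω => ?_)
  rw [Real.norm_of_nonneg (Nat.cast_nonneg _)]
  exact_mod_cast A.level_le node t ω

lemma integral_level_le [IsProbabilityMeasure P] (A : LooplessRun f master c₀ q₀ x₀ T P)
    {node : ℕ → Fin n} (hnode : ∀ k, node k ≠ master) {t : ℕ} (ht : t ≤ T) :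
    ∫ ω, (A.level node t ω : ℝ) ∂P ≤ 1 + t * ((q₀ + 2 * c₀) / n) := by
  induction t with
  | zero => simp [level]
  | succ t ih =>
    specialize ih (by omega)
    set τ : Fin T := ⟨t, by omega⟩ with hτ
    set E : Set Ω := {ω | A.i τ ω = node (A.level node t ω)} with hE
    set F : Set Ω := {ω | A.a τ ω = true} with hF
    have hEm : MeasurableSet E :=
      measurableSet_eq_fun (A.i_meas τ) (measurable_from_top.comp (A.measurable_level node t))
    have hFm : MeasurableSet F := A.a_meas τ (measurableSet_singleton true)
    have hlev : ∀ ω, (A.level node (t + 1) ω : ℝ) =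
        A.level node t ω + E.indicator 1 ω + 2 * F.indicator 1 ω := by
      intro ω
      have h : A.level node (t + 1) ω = A.level node t ω +
          (if A.i τ ω = node (A.level node t ω) then 1 else 0) +
          (if A.a τ ω = true then 2 else 0) := A.level_succ node τ ω
      rw [h, Set.indicator_apply, Set.indicator_apply]
      simp only [hE, hF, Set.mem_ofPred_eq, Pi.one_apply]
      push_cast
      simp
    have hEi : Integrable (E.indicator (1 : Ω → ℝ)) P := (integrable_const 1).indicator hEm
    have hFi : Integrable (F.indicator (1 : Ω → ℝ)) P := (integrable_const 1).indicator hFm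
    have hEP : P.real E ≤ q₀ / n := A.measureReal_hit_le hnode τ
    have hFP : P.real F ≤ c₀ / n := (A.a_law τ).trans_le A.p_le
    have hLE : Integrable (fun ω => (A.level node t ω : ℝ) + E.indicator 1 ω) P :=
      (A.integrable_level node t).add hEi
    rw [integral_congr_ae (Filter.Eventually.of_forall hlev),
      integral_add hLE (hFi.const_mul 2),
      integral_add (A.integrable_level node t) hEi, integral_const_mul,
      integral_indicator_one hEm, integral_indicator_one hFm]
    push_cast
    have : (q₀ + 2 * c₀) / (n : ℝ) = q₀ / n + 2 * (c₀ / n) := by ring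
    rw [this] at ih ⊢
    linarith

/-- Markov's inequality for the level. -/
lemma mul_measureReal_level_gt_le [IsProbabilityMeasure P]
    (A : LooplessRun f master c₀ q₀ x₀ T P) {node : ℕ → Fin n} (hnode : ∀ k, node k ≠ master)
    (M : ℕ) :
    M * P.real {ω | M < A.level node T ω} ≤ T * ((q₀ + 2 * c₀) / n) := by
  have hint : Integrable (fun ω => (A.level node T ω : ℝ) - 1) P :=
    (A.integrable_level node T).sub (integrable_const 1)
  have h0 : ∀ ω, (0 : ℝ) ≤ (A.level node T ω : ℝ) - 1 := fun ω =>
    sub_nonneg.mpr (by exact_mod_cast A.one_le_level node T ω)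
  have h := mul_meas_ge_le_integral_of_nonneg (μ := P) (Filter.Eventually.of_forall h0) hint M
  -- Applying Markov to `level - 1` turns the weak inequality into the strict one and cancels the
  -- initial value `1` in the expectation.
  have hset : {ω | (M : ℝ) ≤ (A.level node T ω : ℝ) - 1} = {ω | M < A.level node T ω} := by
    ext ω
    simp only [Set.mem_ofPred_eq, le_sub_iff_add_le]
    exact_mod_cast Iff.rfl
  rw [hset, integral_sub (A.integrable_level node T) (integrable_const 1)] at h
  simp only [integral_const, probReal_univ, smul_eq_mul, mul_one] at h
  linarith [A.integral_level_le hnode le_rfl]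

lemma xt_mem (A : LooplessRun f master c₀ q₀ x₀ T P) {t : ℕ} (ht : t ≤ T) (ω : Ω) :
    A.xt t ω ∈ A.I t ω := by
  cases t with
  | zero =>
    rw [A.xt_zero, A.I_zero]
    exact Submodule.subset_span (Or.inl rfl)
  | succ t =>
    have key : ∀ τ : Fin T, A.xt (τ + 1) ω ∈ A.I (τ + 1) ω := by
      intro τ
      cases h : A.a τ ω with
      | false => rw [A.xt_tail τ ω h, A.I_tail τ ω h]; exact A.x_mem τ ω
      | true => exact A.xt_head τ ω h
    exact key ⟨t, by omega⟩

/-- The information sets stay in a filtration `V` through which only the oracle of `node k` leads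
out of `V k`. -/
lemma I_le_level (A : LooplessRun f master c₀ q₀ x₀ T P) {node : ℕ → Fin n}
    (hmaster : ∀ k, node k ≠ master) (V : ℕ → Submodule ℝ (Vec d)) (hV : Monotone V)
    (hnode : ∀ k, 1 ≤ k → ∀ i, i ≠ node k → ∀ x ∈ V k, ∀ γ > 0, pifo (f i) γ x ⊆ V k)
    (hsucc : ∀ k, 1 ≤ k → ∀ i, ∀ x ∈ V k, ∀ γ > 0, pifo (f i) γ x ⊆ V (k + 1))
    (h0 : A.I 0 ≤ fun _ => V 1) {t : ℕ} (ht : t ≤ T) (ω : Ω) :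
    A.I t ω ≤ V (A.level node t ω) := by
  induction t with
  | zero => exact h0 ω
  | succ t ih =>
    specialize ih (by omega)
    have hxt := ih (A.xt_mem (by omega : t ≤ T) ω)
    have hk := A.one_le_level node t ω
    have key : ∀ τ : Fin T, (τ : ℕ) = t → A.I (t + 1) ω ≤ V (A.level node (t + 1) ω) := by
      rintro τ rfl
      rw [A.level_succ]
      set k := A.level node τ ω with hkdef
      set k' := k + (if A.i τ ω = node k then 1 else 0) with hk'
      have hkk' : k ≤ k' := Nat.le_add_right _ _
      have hI0 : A.I0 (τ + 1) ω ≤ V k' := by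
        rw [A.I0_succ τ ω, Submodule.span_le]
        refine Set.union_subset (ih.trans (hV hkk')) ?_
        by_cases h : A.i τ ω = node k
        · rw [hk', if_pos h]
          exact hsucc k hk _ _ hxt _ (A.γ_pos _ _)
        · exact (hnode k hk _ h _ hxt _ (A.γ_pos _ _)).trans (hV hkk')
      -- The master is never the useful node, so its calls gain nothing, whatever points are
      -- queried.
      have hm : ∀ z ∈ V k', pifo (f master) (A.γm τ ω) z ⊆ V k' := fun z hz =>
        hnode k' (hk.trans hkk') _ (hmaster k').symm z hz _ (A.γm_pos _ _)
      have hI1 : A.I1 (τ + 1) ω ≤ V k' := by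
        rw [A.I1_succ τ ω, Submodule.span_le]
        exact Set.union_subset hI0 (Set.iUnion₂_subset fun z hz => hm z (hI0 hz))
      cases h : A.a τ ω with
      | false =>
        rw [A.I_tail τ ω h]
        simpa using hI1
      | true =>
        have hk1 : 1 ≤ k' := hk.trans hkk'
        have hV1 : V k' ≤ V (k' + 1) := hV (Nat.le_succ _)
        -- The extra client gains at most one level here; the calls at the anchor gain at most one
        -- more below.
        have hyt : A.yt (τ + 1) ω ∈ V (k' + 1) := by
          refine Submodule.span_le.mpr (Set.union_subset (Set.union_subset ?_ ?_) ?_)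
            (A.yt_mem τ ω h)
          · exact hI1.trans hV1
          · exact Set.iUnion₂_subset fun z hz => (hm z (hI1 hz)).trans hV1
          · exact hsucc k' hk1 _ _ (hI1 (A.y_mem τ ω h)) _ (A.γj_pos _ _)
        have hV2 : V (k' + 1) ≤ V (k' + 2) := hV (Nat.le_succ _)
        rw [A.I_head τ ω h, Submodule.span_le, if_pos rfl]
        refine Set.union_subset (Set.union_subset (hI1.trans (hV1.trans hV2)) ?_) ?_
        · exact Set.singleton_subset_iff.mpr (hV2 hyt)
        · exact Set.iUnion_subset fun i => hsucc (k' + 1) (by omega) i _ hyt _ (A.γ_pos _ _)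
    exact key ⟨t, by omega⟩ rfl

lemma le_integral_comm [IsProbabilityMeasure P] (A : LooplessRun f master c₀ q₀ x₀ T P)
    (hn : 1 ≤ n) : 2 * ((n : ℝ) - 1) + 2 * T ≤ ∫ ω, A.comm ω ∂P := by
  have hn' : (1 : ℝ) ≤ n := by exact_mod_cast hn
  have hmeas : ∀ t : Fin T, Measurable fun ω =>
      (2 + if A.a t ω = true then 2 + 2 * ((n : ℝ) - 1) else 0) := fun t =>
    (measurable_of_countable fun b : Bool =>
      (2 + if b = true then 2 + 2 * ((n : ℝ) - 1) else 0)).comp (A.a_meas t)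
  have hint : Integrable A.comm P := by
    refine (integrable_const _).add (integrable_finsetSum _ fun t _ => ?_)
    refine Integrable.of_bound (hmeas t).aestronglyMeasurable (2 + (2 + 2 * ((n : ℝ) - 1)))
      (Filter.Eventually.of_forall fun ω => ?_)
    rw [Real.norm_eq_abs, abs_le]
    constructor <;> split_ifs <;> linarith
  have hle : ∀ ω, 2 * ((n : ℝ) - 1) + 2 * T ≤ A.comm ω := by
    intro ω
    unfold comm
    have : ∑ _t : Fin T, (2 : ℝ) ≤
        ∑ t : Fin T, (2 + if A.a t ω = true then 2 + 2 * ((n : ℝ) - 1) else 0) := by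
      refine Finset.sum_le_sum fun t _ => ?_
      split_ifs <;> linarith
    rw [Finset.sum_const, Finset.card_univ, Fintype.card_fin, nsmul_eq_mul] at this
    linarith
  simpa using integral_mono (integrable_const (μ := P) _) hint hle

end LooplessRun

/-! ### Relations between the parameters of the instance. -/

lemma one_lt_hardRho {n : ℕ} {δ μ : ℝ} (hδ : 0 < δ) (hμ : 0 < μ) : 1 < hardRho n δ μ := by
  unfold hardRho
  rw [Real.lt_sqrt zero_le_one]
  have : 0 < 2 * (δ / μ) / Real.sqrt (2 * n + 1) := by positivity
  linarith

lemma hardRho_sq {n : ℕ} {δ μ : ℝ} (hδ : 0 < δ) (hμ : 0 < μ) :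
    hardRho n δ μ ^ 2 = 2 * (δ / μ) / Real.sqrt (2 * n + 1) + 1 :=
  Real.sq_sqrt (by positivity)

lemma hardQ_pos {n : ℕ} {δ μ : ℝ} (hδ : 0 < δ) (hμ : 0 < μ) : 0 < hardQ n δ μ := by
  have := one_lt_hardRho (n := n) hδ hμ
  exact div_pos (by linarith) (by linarith)

lemma one_sub_hardQ {n : ℕ} {δ μ : ℝ} (hδ : 0 < δ) (hμ : 0 < μ) :
    1 - hardQ n δ μ = 2 / (hardRho n δ μ + 1) := by
  have := one_lt_hardRho (n := n) hδ hμ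
  unfold hardQ
  rw [eq_div_iff (by linarith), sub_mul, div_mul_cancel₀ _ (by linarith)]
  ring

lemma hardQ_lt_one {n : ℕ} {δ μ : ℝ} (hδ : 0 < δ) (hμ : 0 < μ) : hardQ n δ μ < 1 := by
  have := one_lt_hardRho (n := n) hδ hμ
  have h := one_sub_hardQ (n := n) hδ hμ
  have : 0 < 2 / (hardRho n δ μ + 1) := by positivity
  linarith

lemma hardZeta_sq {n : ℕ} {δ μ : ℝ} (hδ : 0 < δ) (hμ : 0 < μ) :
    hardZeta n δ μ ^ 2 = 1 - hardQ n δ μ := by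
  have := one_lt_hardRho (n := n) hδ hμ
  rw [one_sub_hardQ hδ hμ, hardZeta, Real.sq_sqrt (by positivity), add_comm]

lemma hardC_nonneg {n : ℕ} {δ μ : ℝ} (hδ : 0 < δ) (hμ : 0 < μ) : 0 ≤ hardC n δ μ := by
  have := one_lt_hardRho (n := n) hδ hμ
  exact div_nonneg (by norm_num) (by nlinarith)

lemma hardC_mul_hardQ {n : ℕ} {δ μ : ℝ} (hδ : 0 < δ) (hμ : 0 < μ) :
    hardC n δ μ * hardQ n δ μ = (1 - hardQ n δ μ) ^ 2 := by
  have h := one_lt_hardRho (n := n) hδ hμ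
  rw [one_sub_hardQ hδ hμ]
  unfold hardC hardQ
  have h1 : hardRho n δ μ - 1 ≠ 0 := by linarith
  have h2 : hardRho n δ μ + 1 ≠ 0 := by linarith
  rw [show hardRho n δ μ ^ 2 - 1 = (hardRho n δ μ - 1) * (hardRho n δ μ + 1) by ring]
  field_simp
  norm_num

lemma hardBeta_pos {n : ℕ} {δ μ Δ : ℝ} (hδ : 0 < δ) (hμ : 0 < μ) (hΔ : 0 < Δ) :
    0 < hardBeta n δ μ Δ := by
  have := one_lt_hardRho (n := n) hδ hμ
  have : 0 < hardRho n δ μ - 1 := by linarith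
  unfold hardBeta
  positivity

lemma hardLambda_mul_inv_hardBeta_sq {n : ℕ} {δ μ Δ : ℝ} (hδ : 0 < δ) (hμ : 0 < μ) (hΔ : 0 < Δ) :
    hardLambda n δ μ Δ * (hardBeta n δ μ Δ)⁻¹ ^ 2 = μ * (hardRho n δ μ ^ 2 - 1) / 4 := by
  have h := one_lt_hardRho (n := n) hδ hμ
  have h1 : hardRho n δ μ - 1 ≠ 0 := by linarith
  have h2 : hardRho n δ μ + 1 ≠ 0 := by linarith
  have hb : hardBeta n δ μ Δ ^ 2 =
      (4 / (hardRho n δ μ - 1)) ^ 2 * (Δ / (μ * (hardRho n δ μ + 1))) := by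
    rw [hardBeta, mul_pow, Real.sq_sqrt (by positivity)]
  rw [inv_pow, hb, hardLambda]
  field_simp
  ring

lemma mul_hardC {n : ℕ} {δ μ Δ : ℝ} (hδ : 0 < δ) (hμ : 0 < μ) (hΔ : 0 < Δ) :
    hardLambda n δ μ Δ * (hardBeta n δ μ Δ)⁻¹ ^ 2 * hardC n δ μ = μ := by
  have h := one_lt_hardRho (n := n) hδ hμ
  have h1 : hardRho n δ μ ^ 2 - 1 ≠ 0 := by nlinarith
  rw [hardLambda_mul_inv_hardBeta_sq hδ hμ hΔ, hardC]
  field_simp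

/-- The choice of `ρ` makes `θ = μ (ρ² - 1) / 4` equal to `δ / (2 √(2 n + 1))`. -/
lemma hard_smoothness {n : ℕ} {δ μ Δ : ℝ} (hδ : 0 < δ) (hμ : 0 < μ) (hΔ : 0 < Δ) :
    (hardLambda n δ μ Δ * (hardBeta n δ μ Δ)⁻¹ ^ 2) ^ 2 * (4 * (2 * n + 1)) = δ ^ 2 := by
  rw [hardLambda_mul_inv_hardBeta_sq hδ hμ hΔ, hardRho_sq hδ hμ]
  have hs : Real.sqrt (2 * n + 1) ^ 2 = 2 * n + 1 := Real.sq_sqrt (by positivity)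
  have h0 : Real.sqrt (2 * n + 1) ≠ 0 := by positivity
  have h1 : μ * (2 * (δ / μ) / Real.sqrt (2 * n + 1) + 1 - 1) / 4 =
      δ / (2 * Real.sqrt (2 * n + 1)) := by
    field_simp
    ring
  rw [h1, div_pow, mul_pow, hs]
  field_simp
  norm_num

/-- The scale of the minimizer of the hard instance. -/
def hardScale (n : ℕ) (δ μ Δ : ℝ) : ℝ := hardBeta n δ μ Δ / (1 - hardQ n δ μ)

lemma hardScale_eq {n : ℕ} {δ μ Δ : ℝ} (hδ : 0 < δ) (hμ : 0 < μ) (hΔ : 0 < Δ) :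
    hardLambda n δ μ Δ * (hardBeta n δ μ Δ)⁻¹ ^ 2 * (hardScale n δ μ Δ * (1 - hardQ n δ μ)) =
      hardLambda n δ μ Δ * (hardBeta n δ μ Δ)⁻¹ := by
  have hb := (hardBeta_pos (n := n) hδ hμ hΔ).ne'
  have hq := hardQ_lt_one (n := n) hδ hμ
  rw [hardScale, div_mul_cancel₀ _ (by linarith)]
  field_simp

lemma hard_gap {n : ℕ} {δ μ Δ : ℝ} (hδ : 0 < δ) (hμ : 0 < μ) (hΔ : 0 < Δ) :
    hardLambda n δ μ Δ * (hardBeta n δ μ Δ)⁻¹ ^ 2 / 2 *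
      (hardScale n δ μ Δ ^ 2 * (1 - hardQ n δ μ) * hardQ n δ μ) = Δ := by
  have hb := (hardBeta_pos (n := n) hδ hμ hΔ).ne'
  have h := one_lt_hardRho (n := n) hδ hμ
  have h1 : hardRho n δ μ - 1 ≠ 0 := by linarith
  have h2 : hardRho n δ μ + 1 ≠ 0 := by linarith
  rw [hardScale, one_sub_hardQ hδ hμ, hardLambda, hardQ]
  field_simp
  ring

lemma log_inv_hardQ_pos {n : ℕ} {δ μ : ℝ} (hδ : 0 < δ) (hμ : 0 < μ) :
    0 < Real.log (1 / hardQ n δ μ) :=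
  Real.log_pos (by rw [one_div]; exact one_lt_inv_iff₀.mpr ⟨hardQ_pos hδ hμ, hardQ_lt_one hδ hμ⟩)

lemma three_mul_log_le {n : ℕ} {δ μ Δ ε : ℝ} (hδ : 0 < δ) (hμ : 0 < μ) (hε : 0 < ε)
    (h : ε ≤ Δ / 9 * hardQ n δ μ ^ 3) :
    3 * Real.log (1 / hardQ n δ μ) ≤ Real.log (Δ / (9 * ε)) := by
  have hq := hardQ_pos (n := n) hδ hμ
  have h3 : (3 : ℝ) * Real.log (1 / hardQ n δ μ) = Real.log ((1 / hardQ n δ μ) ^ 3) := by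
    rw [Real.log_pow]; norm_num
  rw [h3]
  refine Real.log_le_log (by positivity) ?_
  rw [one_div, inv_pow, inv_eq_one_div, div_le_div_iff₀ (by positivity) (by positivity)]
  linarith

/-- `M` is the level that must be passed. The first logarithmic bound keeps the excess at level `M`
above `9 ε`; the second converts `M` back into `log (Δ / (9 ε))`. -/
lemma two_mul_sub_le_log {n : ℕ} {δ μ Δ ε : ℝ} (hδ : 0 < δ) (hμ : 0 < μ) (hε : 0 < ε)
    (h : ε ≤ Δ / 9 * hardQ n δ μ ^ 3) :
    ∃ M : ℕ, hardDim n δ μ Δ ε = M + 2 ∧ 1 ≤ M ∧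
      2 * M * Real.log (1 / hardQ n δ μ) ≤ Real.log (Δ / (9 * ε)) ∧
      Real.log (Δ / (9 * ε)) ≤ 4 * M * Real.log (1 / hardQ n δ μ) := by
  have hl := log_inv_hardQ_pos (n := n) hδ hμ
  have h3 := three_mul_log_le hδ hμ hε h
  set ℓ := Real.log (1 / hardQ n δ μ) with hℓ
  set Λ := Real.log (Δ / (9 * ε)) with hΛ
  -- The assumption on `ε` gives `Λ ≥ 3 ℓ`. This yields `M ≥ 1`, so rounding down costs at most a
  -- factor two.
  have hL : 1 ≤ Λ / (2 * ℓ) := by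
    rw [le_div_iff₀ (by positivity)]; linarith
  refine ⟨⌊Λ / (2 * ℓ)⌋₊, ?_, ?_, ?_, ?_⟩
  · unfold hardDim
    rw [← hℓ, ← hΛ]
    exact_mod_cast Nat.floor_add_natCast (by linarith : 0 ≤ Λ / (2 * ℓ)) 2
  · exact Nat.le_floor (by exact_mod_cast hL)
  · have := Nat.floor_le (by linarith : 0 ≤ Λ / (2 * ℓ))
    rw [le_div_iff₀ (by positivity)] at this
    linarith
  · have h1 : 1 ≤ ⌊Λ / (2 * ℓ)⌋₊ := Nat.le_floor (by exact_mod_cast hL)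
    have h1' : (1 : ℝ) ≤ ⌊Λ / (2 * ℓ)⌋₊ := by exact_mod_cast h1
    have h2 := Nat.lt_floor_add_one (Λ / (2 * ℓ))
    rw [div_lt_iff₀ (by positivity)] at h2
    nlinarith

lemma nine_mul_le_hardQ_pow {n M : ℕ} {δ μ Δ ε : ℝ} (hδ : 0 < δ) (hμ : 0 < μ) (hΔ : 0 < Δ)
    (hε : 0 < ε) (h : 2 * M * Real.log (1 / hardQ n δ μ) ≤ Real.log (Δ / (9 * ε))) :
    9 * ε ≤ Δ * hardQ n δ μ ^ (2 * M) := by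
  have hq := hardQ_pos (n := n) hδ hμ
  have h1 : Real.log ((1 / hardQ n δ μ) ^ (2 * M)) ≤ Real.log (Δ / (9 * ε)) := by
    rw [Real.log_pow]; push_cast; linarith
  rw [Real.log_le_log_iff (by positivity) (by positivity), one_div, inv_pow, inv_eq_one_div,
    div_le_div_iff₀ (by positivity) (by positivity)] at h1
  linarith

lemma log_one_div_le {Δ ε : ℝ} (hΔ : 0 < Δ) (hε : 0 < ε) (h : ε ≤ (Δ / 9) ^ 2) :
    Real.log (1 / ε) ≤ 2 * Real.log (Δ / (9 * ε)) := by
  have h2 : 2 * Real.log (Δ / (9 * ε)) = Real.log ((Δ / (9 * ε)) ^ 2) := by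
    rw [Real.log_pow]; norm_num
  rw [h2]
  refine Real.log_le_log (by positivity) ?_
  have h3 : (Δ / (9 * ε)) ^ 2 = (Δ / 9) ^ 2 / ε ^ 2 := by field_simp
  rw [h3, div_le_div_iff₀ hε (by positivity)]
  nlinarith

/-! ### The size of `n / log (1 / q)` in the two regimes. -/

lemma sqrt_two_mul_add_one_le {n : ℕ} (hn : 3 ≤ n) :
    Real.sqrt (2 * n + 1) ≤ 2 * Real.sqrt n := by
  have hn' : (3 : ℝ) ≤ n := by exact_mod_cast hn
  rw [show (2 : ℝ) * Real.sqrt n = Real.sqrt (4 * n) by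
    rw [Real.sqrt_mul (by norm_num), show (4 : ℝ) = 2 ^ 2 by norm_num, Real.sqrt_sq (by norm_num)]]
  exact Real.sqrt_le_sqrt (by linarith)

/-- The rate of the instance when the similarity constant is large. -/
lemma rate_of_large {n : ℕ} (hn : 3 ≤ n) {δ μ K : ℝ} (hδ : 0 < δ) (hμ : 0 < μ) (hK : 0 < K)
    (h : K * Real.sqrt n ≤ δ / μ) :
    1 / (2 * (1 + 2 / Real.sqrt K)) * ((n : ℝ) ^ (3 / 4 : ℝ) * Real.sqrt (δ / μ)) ≤
      n / Real.log (1 / hardQ n δ μ) := by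
  have hn0 : (0 : ℝ) < n := by positivity
  have hρ := one_lt_hardRho (n := n) hδ hμ
  have hℓ := log_inv_hardQ_pos (n := n) hδ hμ
  have hsq := hardRho_sq (n := n) hδ hμ
  have hq := hardQ_pos (n := n) hδ hμ
  set s := δ / μ with hs
  have hs0 : 0 < s := by positivity
  set w := 2 * s / Real.sqrt (2 * n + 1) with hw
  have hw0 : 0 < w := by positivity
  set ρ := hardRho n δ μ with hρdef
  have hsn : 0 < Real.sqrt n := Real.sqrt_pos.mpr hn0
  have hws : s / Real.sqrt n ≤ w := by
    rw [hw, div_le_div_iff₀ hsn (by positivity)]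
    nlinarith [sqrt_two_mul_add_one_le hn]
  have hwK : K ≤ w := by
    refine le_trans ?_ hws
    rwa [le_div_iff₀ hsn]
  have hsw : Real.sqrt K ≤ Real.sqrt w := Real.sqrt_le_sqrt hwK
  have hsK : 0 < Real.sqrt K := Real.sqrt_pos.mpr hK
  have hsw0 : 0 < Real.sqrt w := Real.sqrt_pos.mpr hw0
  have hww : Real.sqrt w ^ 2 = w := Real.sq_sqrt hw0.le
  have hρw : ρ ≤ Real.sqrt w + 1 := by
    nlinarith
  set D := 1 + 2 / Real.sqrt K with hD
  have hD0 : 0 < D := by positivity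
  have hρ1 : ρ + 1 ≤ Real.sqrt w * D := by
    have : 2 ≤ Real.sqrt w * (2 / Real.sqrt K) := by
      rw [mul_div_assoc', le_div_iff₀ hsK]
      linarith
    rw [hD]
    linarith
  -- From `w = (ρ - 1) (ρ + 1)` and the bound on `ρ + 1`, after dividing by `√w`.
  have hρ2 : Real.sqrt w ≤ (ρ - 1) * D := by
    have h1 : Real.sqrt w ^ 2 ≤ Real.sqrt w * ((ρ - 1) * D) := by
      rw [hww]
      nlinarith
    exact le_of_mul_le_mul_left (by linarith [sq (Real.sqrt w)]) hsw0
  have hlog : Real.log (1 / hardQ n δ μ) ≤ 2 / (ρ - 1) := by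
    have h1 := Real.log_le_sub_one_of_pos (show 0 < 1 / hardQ n δ μ by positivity)
    have h2 : 1 / hardQ n δ μ - 1 = 2 / (ρ - 1) := by
      have : ρ - 1 ≠ 0 := by linarith
      have : ρ + 1 ≠ 0 := by linarith
      unfold hardQ
      rw [← hρdef]
      field_simp
      ring
    linarith
  -- The square of this is `n ^ (3 / 2) * s ≤ n² * w`, that is, `s / √n ≤ w`.
  have hpow : (n : ℝ) ^ (3 / 4 : ℝ) * Real.sqrt s ≤ n * Real.sqrt w := by
    apply le_of_sq_le_sq _ (by positivity)
    have h1 : ((n : ℝ) ^ (3 / 4 : ℝ)) ^ 2 = n * Real.sqrt n := by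
      rw [← Real.rpow_natCast, ← Real.rpow_mul hn0.le, Real.sqrt_eq_rpow]
      nth_rewrite 2 [← Real.rpow_one (n : ℝ)]
      rw [← Real.rpow_add hn0]
      norm_num
    rw [mul_pow, mul_pow, h1, Real.sq_sqrt hs0.le, hww]
    have h2 : s * Real.sqrt n ≤ n * w := by
      rw [div_le_iff₀ hsn] at hws
      have hnn : Real.sqrt n * Real.sqrt n = n := Real.mul_self_sqrt hn0.le
      calc s * Real.sqrt n ≤ w * Real.sqrt n * Real.sqrt n := by gcongr
        _ = n * w := by rw [mul_assoc, hnn, mul_comm]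
    nlinarith
  rw [le_div_iff₀ hℓ]
  have hρ3 : 0 < ρ - 1 := by linarith
  calc 1 / (2 * D) * ((n : ℝ) ^ (3 / 4 : ℝ) * Real.sqrt s) * Real.log (1 / hardQ n δ μ)
      ≤ 1 / (2 * D) * (n * ((ρ - 1) * D)) * (2 / (ρ - 1)) := by
        have h1 := hpow.trans (mul_le_mul_of_nonneg_left hρ2 hn0.le)
        gcongr
    _ = n := by field_simp

/-- The rate of the instance when the similarity constant is small. -/
lemma rate_of_small {n : ℕ} (hn : 3 ≤ n) {δ μ K : ℝ} (hδ : 0 < δ) (hμ : 0 < μ) (hK : 0 < K)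
    (h : δ / μ ≤ K * Real.sqrt n) :
    1 / (2 * Real.log (Real.sqrt (2 * K + 1) + 1) + 1) *
      (n / (1 + max (Real.log (μ * Real.sqrt n / δ)) 0)) ≤
      n / Real.log (1 / hardQ n δ μ) := by
  have hn0 : (0 : ℝ) < n := by positivity
  have hρ := one_lt_hardRho (n := n) hδ hμ
  have hℓ := log_inv_hardQ_pos (n := n) hδ hμ
  have hsq := hardRho_sq (n := n) hδ hμ
  have hq := hardQ_pos (n := n) hδ hμ
  set w := 2 * (δ / μ) / Real.sqrt (2 * n + 1) with hw
  have hw0 : 0 < w := by positivity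
  have hsn : 0 < Real.sqrt n := Real.sqrt_pos.mpr hn0
  have hwK : w ≤ 2 * K := by
    rw [hw, div_le_iff₀ (by positivity)]
    have : Real.sqrt n ≤ Real.sqrt (2 * n + 1) := Real.sqrt_le_sqrt (by linarith)
    nlinarith
  have hρK : hardRho n δ μ ≤ Real.sqrt (2 * K + 1) :=
    Real.sqrt_le_sqrt (by linarith)
  set ρ := hardRho n δ μ with hρdef
  have hinv : 1 / w ≤ μ * Real.sqrt n / δ := by
    rw [hw, one_div_div, div_le_div_iff₀ (by positivity) hδ]
    have h1 := sqrt_two_mul_add_one_le hn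
    calc Real.sqrt (2 * n + 1) * δ ≤ 2 * Real.sqrt n * δ := by gcongr
      _ = μ * Real.sqrt n * (2 * (δ / μ)) := by field_simp
  -- Since `w = (ρ - 1) (ρ + 1)`, one has `1 / q = (ρ + 1)² / w`. In this regime `ρ` is bounded in
  -- terms of `K`, so only `1 / w` can be large.
  have hlog : Real.log (1 / hardQ n δ μ) = 2 * Real.log (ρ + 1) + Real.log (1 / w) := by
    have h1 : (2 : ℝ) * Real.log (ρ + 1) = Real.log ((ρ + 1) ^ 2) := by
      rw [Real.log_pow]; norm_num
    rw [h1, ← Real.log_mul (by positivity) (by positivity)]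
    congr 1
    have h2 : w = (ρ - 1) * (ρ + 1) := by linarith
    have : ρ - 1 ≠ 0 := by linarith
    have : ρ + 1 ≠ 0 := by linarith
    rw [h2]
    unfold hardQ
    rw [← hρdef]
    field_simp
  have h1 : Real.log (ρ + 1) ≤ Real.log (Real.sqrt (2 * K + 1) + 1) :=
    Real.log_le_log (by linarith) (by linarith)
  have h2 : Real.log (1 / w) ≤ max (Real.log (μ * Real.sqrt n / δ)) 0 :=
    (Real.log_le_log (by positivity) hinv).trans (le_max_left _ _)
  have h3 : 0 ≤ Real.log (Real.sqrt (2 * K + 1) + 1) :=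
    Real.log_nonneg (by linarith [Real.sqrt_nonneg (2 * K + 1)])
  have h4 : 0 ≤ max (Real.log (μ * Real.sqrt n / δ)) 0 := le_max_right _ _
  rw [div_mul_div_comm, one_mul]
  refine div_le_div_of_nonneg_left hn0.le hℓ ?_
  rw [hlog]
  -- With `L` the logarithm depending on `K` and `x` the positive part, this is `2 L + x ≤ (2 L + 1)
  -- (1 + x)`.
  nlinarith [mul_nonneg h3 h4]

/-! ### From expected error to rounds and to communication cost. -/

/-- A run with expected error below `ε` has many rounds. -/
lemma rounds_lower_bound {n : ℕ} (hn : 3 ≤ n) {c₀ q₀ ζ c θ η q a ε : ℝ} {M T : ℕ}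
    (hζ : ζ ^ 2 = 1 - q) (hc : c * q = (1 - q) ^ 2)
    (ha : θ * (a * (1 - q)) = η) (hθ : 0 ≤ θ) (hc0 : 0 ≤ c)
    (hgap : 9 * ε ≤ θ / 2 * (a ^ 2 * (1 - q) * q ^ (2 * M + 1))) (hε : 0 < ε)
    {Ω : Type*} [MeasurableSpace Ω] {P : Measure Ω} [IsProbabilityMeasure P]
    {master : Fin n} (hm : (master : ℕ) = 0)
    (A : LooplessRun (quadComp n (M + 2) ζ c θ η) master c₀ q₀ 0 T P)
    (hint : Integrable (fun ω => avgFun (quadComp n (M + 2) ζ c θ η) (A.out ω)) P)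
    (herr : (∫ ω, avgFun (quadComp n (M + 2) ζ c θ η) (A.out ω) ∂P) -
      avgFun (quadComp n (M + 2) ζ c θ η) (geomVec (M + 2) a q) < ε) :
    8 / 9 * (n * M) ≤ T * (q₀ + 2 * c₀) := by
  have hn0 : (0 : ℝ) < n := by positivity
  set F := avgFun (quadComp n (M + 2) ζ c θ η) with hF
  set G := θ / 2 * (a ^ 2 * (1 - q) * q ^ (2 * M + 1)) with hG
  have hmaster := rowNode_ne_master hn hm
  set S : Set Ω := {ω | M < A.level (rowNode n hn) T ω} with hS
  have hSm : MeasurableSet S :=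
    A.measurable_level (rowNode n hn) T (measurableSet_Ioi (a := M))
  have hlevel : ∀ ω, A.out ω ∈ prefixSpace (M + 2) (A.level (rowNode n hn) T ω) := fun ω =>
    A.I_le_level hmaster (prefixSpace (M + 2)) (fun _ _ => prefixSpace_mono)
      (fun k hk i hi x hx γ hγ => pifo_quadComp_subset hn hθ hc0 hk hi hx hγ)
      (fun k hk i x hx γ hγ => pifo_quadComp_subset_succ hn hθ hc0 hk i hx hγ)
      (by
        intro ω
        rw [A.I_zero ω, Submodule.span_le]
        refine Set.union_subset (Set.singleton_subset_iff.mpr (zero_mem _))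
          (Set.iUnion_subset fun k => ?_)
        -- The owner of the first row could leave level `1` from a general point, but the start is
        -- `0`, where a client returns only `0`.
        by_cases hk : k = rowNode n hn 1
        · exact (pifo_quadComp_zero_subset hθ hc0 (by simp [hk, rowNode]) (A.γ_pos 0 ω)).trans
            (prefixSpace_mono zero_le_one)
        · exact pifo_quadComp_subset hn hθ hc0 le_rfl hk (zero_mem _) (A.γ_pos 0 ω))
      le_rfl ω (A.out_mem ω)
  have hmin : ∀ x, F (geomVec (M + 2) a q) ≤ F x := fun x =>
    isMinOn_geomVec hn hζ hc ha hθ hc0 (Set.mem_univ x)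
  have hle : ∀ ω, Sᶜ.indicator (fun _ => G) ω ≤ F (A.out ω) - F (geomVec (M + 2) a q) := by
    intro ω
    by_cases hω : ω ∈ S
    · rw [Set.indicator_of_notMem (by simpa using hω)]
      linarith [hmin (A.out ω)]
    · rw [Set.indicator_of_mem (by simpa using hω)]
      exact le_avgFun_quadComp_sub hn hζ hc ha hθ hc0 (by omega)
        (prefixSpace_mono (not_lt.mp hω) (hlevel ω))
  have h1 := integral_mono ((integrable_const G).indicator hSm.compl)
    (hint.sub (integrable_const (F (geomVec (M + 2) a q)))) hle
  have h2 : P.real Sᶜ * G < ε := by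
    rw [integral_indicator_const _ hSm.compl, smul_eq_mul] at h1
    refine h1.trans_lt ?_
    simp only [Pi.sub_apply]
    rw [integral_sub hint (integrable_const _)]
    simpa using herr
  -- Off `S` the excess is at least `9 ε`, while its mean is below `ε`.
  have h3 : P.real Sᶜ < 1 / 9 := by
    have h4 : P.real Sᶜ * (9 * ε) < ε :=
      (mul_le_mul_of_nonneg_left hgap measureReal_nonneg).trans_lt h2
    by_contra! h5
    nlinarith
  rw [probReal_compl_eq_one_sub hSm] at h3
  have h4 := A.mul_measureReal_level_gt_le hmaster M
  rw [← hS] at h4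
  have h5 : (M : ℝ) * (8 / 9) ≤ T * ((q₀ + 2 * c₀) / n) :=
    le_trans (mul_le_mul_of_nonneg_left (by linarith) (Nat.cast_nonneg M)) h4
  rw [mul_div_assoc' (T : ℝ), le_div_iff₀ hn0] at h5
  linarith

/-- The constant is halved to pay for `Λ' ≤ 2 * Λ`, so that one constant serves both `log (Δ / (9
ε))` and `log (1 / ε)`. -/
lemma combine_bounds {n X R Λ Λ' C E : ℝ} (hn : 0 ≤ n) (hC0 : 0 ≤ C)
    (hC1 : C ≤ 1) (hX : 0 ≤ X) (hΛ : 0 ≤ Λ) (hCX : C * X ≤ R) (hE : n + R * Λ ≤ E)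
    (hΛ' : Λ' ≤ 2 * Λ) : C / 2 * (n + X * Λ') ≤ E := by
  have h1 : C * X * Λ ≤ R * Λ := mul_le_mul_of_nonneg_right hCX hΛ
  have h2 : C * X * Λ' ≤ C * X * (2 * Λ) := mul_le_mul_of_nonneg_left hΛ' (by positivity)
  nlinarith

end

theorem theorem3 (c₀ q₀ K : ℝ) (hc₀ : 0 < c₀) (hq₀ : 0 < q₀) (hK : 0 < K) :
    ∃ C : ℝ, 0 < C ∧
      ∀ (n : ℕ) (hn : 3 ≤ n) (δ μ Δ ε : ℝ), 0 < δ → 0 < μ → 0 < Δ → 0 < ε →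
        ε ≤ Δ / 9 * hardQ n δ μ ^ 3 →
        ∀ m : ℕ, m = hardDim n δ μ Δ ε →
        -- the instance is strongly convex, similar, and has initial gap `Δ`
        StrongConvexOn Set.univ μ (avgFun (hardF n m δ μ Δ)) ∧
        AveSS (hardF n m δ μ Δ) δ ∧
        ∃ xs : Vec m, IsMinOn (avgFun (hardF n m δ μ Δ)) Set.univ xs ∧
          avgFun (hardF n m δ μ Δ) 0 - avgFun (hardF n m δ μ Δ) xs = Δ ∧
          -- every run from `0` with expected error below `ε` is expensive
          ∀ (Ω : Type*) [MeasurableSpace Ω] (P : Measure Ω) [IsProbabilityMeasure P] (T : ℕ)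
            (A : LooplessRun (hardF n m δ μ Δ) ⟨0, by omega⟩ c₀ q₀ 0 T P),
            Integrable (fun ω => avgFun (hardF n m δ μ Δ) (A.out ω)) P →
            (∫ ω, avgFun (hardF n m δ μ Δ) (A.out ω) ∂P) - avgFun (hardF n m δ μ Δ) xs < ε →
            (K * Real.sqrt n ≤ δ / μ →
              C * (n + (n : ℝ) ^ (3 / 4 : ℝ) * Real.sqrt (δ / μ) * Real.log (Δ / (9 * ε)))
                  ≤ ∫ ω, A.comm ω ∂P ∧
              (ε ≤ (Δ / 9) ^ 2 →
                C * (n + (n : ℝ) ^ (3 / 4 : ℝ) * Real.sqrt (δ / μ) * Real.log (1 / ε))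
                  ≤ ∫ ω, A.comm ω ∂P)) ∧
            (δ / μ ≤ K * Real.sqrt n →
              C * (n + n * Real.log (Δ / (9 * ε)) /
                    (1 + max (Real.log (μ * Real.sqrt n / δ)) 0))
                  ≤ ∫ ω, A.comm ω ∂P ∧
              (ε ≤ (Δ / 9) ^ 2 →
                C * (n + n * Real.log (1 / ε) /
                    (1 + max (Real.log (μ * Real.sqrt n / δ)) 0))
                  ≤ ∫ ω, A.comm ω ∂P)) := by
  have hs : 0 < q₀ + 2 * c₀ := by positivity
  -- Chosen so that `2 T ≥ (16 / 9) n M / (q₀ + 2 c₀)` and `4 M ℓ ≥ Λ` combine to `2 T ≥ κ (n / ℓ)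
  -- Λ`.
  set κ := 4 / (9 * (q₀ + 2 * c₀)) with hκ
  set C₁ := 1 / (2 * (1 + 2 / Real.sqrt K)) with hC₁
  set C₂ := 1 / (2 * Real.log (Real.sqrt (2 * K + 1) + 1) + 1) with hC₂
  have hκ0 : 0 < κ := by positivity
  have hC₁0 : 0 < C₁ := by positivity
  have hlogK : 0 ≤ Real.log (Real.sqrt (2 * K + 1) + 1) :=
    Real.log_nonneg (by linarith [Real.sqrt_nonneg (2 * K + 1)])
  have hC₂0 : 0 < C₂ := by positivity
  set C := min 1 (min (κ * C₁) (κ * C₂)) with hC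
  have hC0 : 0 < C := lt_min one_pos (lt_min (mul_pos hκ0 hC₁0) (mul_pos hκ0 hC₂0))
  have hC1 : C ≤ 1 := min_le_left _ _
  refine ⟨C / 2, by positivity, fun n hn δ μ Δ ε hδ hμ hΔ hε hεq m hm => ?_⟩
  obtain ⟨M, hM, hM1, hMlow, hMup⟩ := two_mul_sub_le_log hδ hμ hε hεq
  obtain rfl : m = M + 2 := hm.trans hM
  have hΛ3 := three_mul_log_le hδ hμ hε hεq
  have hℓ := log_inv_hardQ_pos (n := n) hδ hμ
  have hζ := hardZeta_sq (n := n) hδ hμ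
  have hcq := hardC_mul_hardQ (n := n) hδ hμ
  have hc0 := hardC_nonneg (n := n) hδ hμ
  have ha := hardScale_eq (n := n) hδ hμ hΔ
  have hgap := hard_gap (n := n) hδ hμ hΔ
  have hq0 := hardQ_pos (n := n) hδ hμ
  have hρ := one_lt_hardRho (n := n) hδ hμ
  have hθ : 0 ≤ hardLambda n δ μ Δ * (hardBeta n δ μ Δ)⁻¹ ^ 2 := by
    rw [hardLambda_mul_inv_hardBeta_sq hδ hμ hΔ]
    have : 0 ≤ hardRho n δ μ ^ 2 - 1 := by nlinarith
    positivity
  have hpow := nine_mul_le_hardQ_pow hδ hμ hΔ hε hMlow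
  rw [hardF_eq_quadComp]
  refine ⟨strongConvexOn_avgFun_quadComp hn hθ (mul_hardC hδ hμ hΔ),
    aveSS_quadComp hn (by rw [hζ]; linarith) (hard_smoothness hδ hμ hΔ),
    geomVec (M + 2) (hardScale n δ μ Δ) (hardQ n δ μ),
    isMinOn_geomVec hn hζ hcq ha hθ hc0,
    (avgFun_quadComp_zero_sub hn hζ hcq ha (by omega)).trans hgap, ?_⟩
  intro Ω _ P _ T A hint herr
  have hT := rounds_lower_bound (M := M) hn hζ hcq ha hθ hc0
    (by
      refine hpow.trans_eq ?_
      nth_rewrite 1 [← hgap]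
      ring) hε rfl A hint herr
  have hcomm := A.le_integral_comm (by omega)
  set Λ := Real.log (Δ / (9 * ε)) with hΛ
  set ℓ := Real.log (1 / hardQ n δ μ) with hℓdef
  have hn3 : (3 : ℝ) ≤ n := by exact_mod_cast hn
  have hΛ0 : 0 ≤ Λ := by linarith
  have hE : (n : ℝ) + κ * (n / ℓ) * Λ ≤ ∫ ω, A.comm ω ∂P := by
    have h1 : κ * (n / ℓ) * Λ ≤ 2 * T := by
      have h2 : κ * (n / ℓ) * Λ ≤ κ * (n / ℓ) * (4 * M * ℓ) :=
        mul_le_mul_of_nonneg_left hMup (by positivity)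
      have h3 : κ * (n / ℓ) * (4 * M * ℓ) = 2 * (8 / 9 * (n * M)) / (q₀ + 2 * c₀) := by
        rw [hκ]
        field_simp
        norm_num
      rw [h3] at h2
      refine h2.trans ?_
      rw [div_le_iff₀ hs]
      linarith
    linarith
  have final : ∀ X C' : ℝ, 0 ≤ X → C ≤ κ * C' → C' * X ≤ n / ℓ → ∀ Λ' ≤ 2 * Λ,
      C / 2 * (n + X * Λ') ≤ ∫ ω, A.comm ω ∂P := by
    intro X C' hX hCC' hX' Λ' hΛ'
    refine combine_bounds (by linarith) hC0.le hC1 hX hΛ0 ?_ hE hΛ'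
    calc C * X ≤ κ * C' * X := mul_le_mul_of_nonneg_right hCC' hX
      _ = κ * (C' * X) := mul_assoc _ _ _
      _ ≤ κ * (n / ℓ) := mul_le_mul_of_nonneg_left hX' hκ0.le
  constructor
  · intro hlarge
    have h := final _ C₁ (by positivity) ((min_le_right _ _).trans (min_le_left _ _))
      (rate_of_large hn hδ hμ hK hlarge)
    exact ⟨h Λ (by linarith), fun hε2 => h _ (log_one_div_le hΔ hε hε2)⟩
  · intro hsmall
    have h0 : 0 ≤ max (Real.log (μ * Real.sqrt n / δ)) 0 := le_max_right _ _
    have h := final _ C₂ (by positivity) ((min_le_right _ _).trans (min_le_right _ _))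
      (rate_of_small hn hδ hμ hK hsmall)
    simp only [mul_div_right_comm (n : ℝ)]
    exact ⟨h Λ (by linarith), fun hε2 => h _ (log_one_div_le hΔ hε hε2)⟩
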